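/- Let $\varphi=(1+\sqrt5)/2$. Every integer $N\ge 0$ has a unique base phi expansion $N=\sum_{i\in\mathbb Z} d_i\varphi^i$ with digits $d_i\in\{0,1\}$, only finitely many of them nonzero, and $d_id_{i+1}=0$ for all $i$. Let $s_\beta(N)=\sum_i d_i$ be the corresponding sum of digits function. An integer $N\ge 0$ is called a point of increase, constancy or decrease of $s_\beta$ if $s_\beta(N+1)-s_\beta(N)$ is positive, zero or negative, respectively. **Theorem.** The set of points of increase of $s_\beta$ is the union of the sets of terms of the two generalized Beatty sequences $$(\lfloor n\varphi\rfloor+2n)_{n\ge 0},\qquad (4\lfloor n\varphi\rfloor+3n+1)_{n\ge 0}.$$ The set of points of constancy of $s_\beta$ is the union of the sets of terms of the four generalized Beatty sequences $$(3\lfloor n\varphi\rfloor+n+1)_{n\ge 1},\quad (4\lfloor n\varphi\rfloor+3n+2)_{n\ge 0},\quad (7\lfloor n\varphi\rfloor+4n+2)_{n\ge 0},\quad (11\lfloor n\varphi\rfloor+7n+4)_{n\ge 0}.$$ The set of points of decrease of $s_\beta$ is the union of the sets of terms of the three generalized Beatty sequences $$(4\lfloor n\varphi\rfloor+3n-1)_{n\ge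 1},\qquad (7\lfloor n\varphi\rfloor+4n)_{n\ge 1},\qquad (7\lfloor n\varphi\rfloor+4n+4)_{n\ge 1}.$$ -/

import Mathlib

/-! ## Base phi expansions -/

/-- `d` is the digit sequence of a base phi expansion of the natural number `N`: finitely many
nonzero digits `d i`, each of them `0` or `1`, no two consecutive digits equal to `1`, and
`N = ∑ i, d i * φ ^ i`, where `i` ranges over all integers. -/
structure IsBasePhiExpansion (N : ℕ) (d : ℤ →₀ ℕ) : Prop where
  digit : ∀ i, d i = 0 ∨ d i = 1
  no_consecutive : ∀ i, ¬ (d i = 1 ∧ d (i + 1) = 1)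
  sum_eq : (N : ℝ) = d.sum fun i a => (a : ℝ) * Real.goldenRatio ^ i

/-! ### Existence and uniqueness of the base phi expansion -/

namespace BasePhi

open Real

/-- A finite set of exponents without two consecutive elements. -/
def Legal (S : Finset ℤ) : Prop := ∀ i ∈ S, i + 1 ∉ S

theorem Legal.mono {S T : Finset ℤ} (hS : Legal S) (h : T ⊆ S) : Legal T :=
  fun i hi hi' => hS i (h hi) (h hi')

theorem phi_zpow_add_two (k : ℤ) :
    goldenRatio ^ (k + 2) = goldenRatio ^ (k + 1) + goldenRatio ^ k := by
  have h0 := goldenRatio_ne_zero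
  rw [zpow_add₀ h0, zpow_add₀ h0]
  norm_cast
  rw [goldenRatio_sq]; ring

theorem psi_zpow_add_two (k : ℤ) :
    goldenConj ^ (k + 2) = goldenConj ^ k * goldenConj ^ 2 := by
  rw [zpow_add₀ goldenConj_ne_zero]; norm_cast

theorem sum_lt (n : ℕ) : ∀ (S : Finset ℤ) (k : ℤ), S.card = n → Legal S → (∀ i ∈ S, i < k) →
    ∑ i ∈ S, goldenRatio ^ i < goldenRatio ^ k := by
  induction n with
  | zero =>
    intro S k hc _ _
    rw [Finset.card_eq_zero] at hc
    subst hc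
    simpa using zpow_pos goldenRatio_pos k
  | succ n ih =>
    intro S k hc hS hk
    have hne : S.Nonempty := by rw [← Finset.card_pos]; omega
    set m := S.max' hne with hm
    have hmS : m ∈ S := S.max'_mem hne
    have hlt : ∀ i ∈ S.erase m, i < m - 1 := by
      intro i hi
      have h1 := S.le_max' i (Finset.mem_of_mem_erase hi)
      have h2 := Finset.ne_of_mem_erase hi
      have h3 : i + 1 ≠ m := fun h => hS i (Finset.mem_of_mem_erase hi) (h ▸ hmS)
      omega
    have := ih (S.erase m) (m - 1) (by rw [Finset.card_erase_of_mem hmS]; omega)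
      (hS.mono (Finset.erase_subset _ _)) hlt
    rw [← Finset.add_sum_erase S _ hmS]
    have h2 := phi_zpow_add_two (m - 1)
    rw [show m - 1 + 2 = m + 1 by ring, show m - 1 + 1 = m by ring] at h2
    have h3 : goldenRatio ^ (m + 1) ≤ goldenRatio ^ k :=
      zpow_le_zpow_right₀ one_lt_goldenRatio.le (by have := hk m hmS; omega)
    linarith

theorem max_le {S T : Finset ℤ} (hS : Legal S)
    (h : ∑ i ∈ S, goldenRatio ^ i = ∑ i ∈ T, goldenRatio ^ i) {m m' : ℤ}
    (hm : ∀ i ∈ S, i ≤ m) (hm' : m' ∈ T) : m' ≤ m := by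
  by_contra hlt
  have h1 := sum_lt _ S m' rfl hS (fun i hi => by have := hm i hi; omega)
  have h2 : goldenRatio ^ m' ≤ ∑ i ∈ T, goldenRatio ^ i :=
    Finset.single_le_sum (f := fun i : ℤ => goldenRatio ^ i)
      (fun i _ => (zpow_pos goldenRatio_pos i).le) hm'
  linarith

theorem unique_aux (n : ℕ) : ∀ (S T : Finset ℤ), S.card = n → Legal S → Legal T →
    ∑ i ∈ S, goldenRatio ^ i = ∑ i ∈ T, goldenRatio ^ i → S = T := by
  induction n with
  | zero =>
    intro S T hc _ _ h
    rw [Finset.card_eq_zero] at hc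
    subst hc
    rcases T.eq_empty_or_nonempty with hT | hT
    · exact hT.symm
    · have := Finset.sum_pos (f := fun i : ℤ => goldenRatio ^ i)
        (fun i _ => zpow_pos goldenRatio_pos i) hT
      rw [← h] at this
      simp at this
  | succ n ih =>
    intro S T hc hS hT h
    have hne : S.Nonempty := by rw [← Finset.card_pos]; omega
    have hneT : T.Nonempty := by
      rw [Finset.nonempty_iff_ne_empty]
      rintro rfl
      have := Finset.sum_pos (f := fun i : ℤ => goldenRatio ^ i)
        (fun i _ => zpow_pos goldenRatio_pos i) hne
      rw [h] at this
      simp at this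
    have h1 := max_le hS h (m := S.max' hne) (fun i hi => S.le_max' i hi) (T.max'_mem hneT)
    have h2 := max_le hT h.symm (m := T.max' hneT) (fun i hi => T.le_max' i hi)
      (S.max'_mem hne)
    have hmS := S.max'_mem hne
    have hmT := T.max'_mem hneT
    rw [le_antisymm h1 h2] at hmT
    set m := S.max' hne
    rw [← Finset.add_sum_erase S _ hmS, ← Finset.add_sum_erase T _ hmT] at h
    have := ih (S.erase m) (T.erase m) (by rw [Finset.card_erase_of_mem hmS]; omega)
      (hS.mono (Finset.erase_subset _ _)) (hT.mono (Finset.erase_subset _ _)) (by linarith)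
    rw [← Finset.insert_erase hmS, ← Finset.insert_erase hmT, this]

/-- `x` and `y` are conjugate elements of `ℤ[φ]`. -/
def Conj (x y : ℝ) : Prop :=
  ∃ a b : ℤ, x = a + b * goldenRatio ∧ y = a + b * goldenConj

theorem Conj.sub {x y x' y' : ℝ} (h : Conj x y) (h' : Conj x' y') : Conj (x - x') (y - y') := by
  obtain ⟨a, b, rfl, rfl⟩ := h
  obtain ⟨c, d, rfl, rfl⟩ := h'
  exact ⟨a - c, b - d, by push_cast; ring, by push_cast; ring⟩

theorem Conj.add {x y x' y' : ℝ} (h : Conj x y) (h' : Conj x' y') : Conj (x + x') (y + y') := by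
  obtain ⟨a, b, rfl, rfl⟩ := h
  obtain ⟨c, d, rfl, rfl⟩ := h'
  exact ⟨a + c, b + d, by push_cast; ring, by push_cast; ring⟩

theorem Conj.mul {x y x' y' : ℝ} (h : Conj x y) (h' : Conj x' y') : Conj (x * x') (y * y') := by
  obtain ⟨a, b, rfl, rfl⟩ := h
  obtain ⟨c, d, rfl, rfl⟩ := h'
  refine ⟨a * c + b * d, a * d + b * c + b * d, ?_, ?_⟩
  · push_cast
    linear_combination (b * d : ℝ) * goldenRatio_sq
  · push_cast
    linear_combination (b * d : ℝ) * goldenConj_sq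

theorem Conj.intCast (n : ℤ) : Conj n n := ⟨n, 0, by simp, by simp⟩

theorem Conj.zpow (k : ℤ) : Conj (goldenRatio ^ k) (goldenConj ^ k) := by
  have hs := goldenRatio_add_goldenConj
  induction k using Int.induction_on with
  | zero => simpa using Conj.intCast 1
  | succ n ih =>
    rw [zpow_add_one₀ goldenRatio_ne_zero, zpow_add_one₀ goldenConj_ne_zero]
    exact ih.mul ⟨0, 1, by simp, by simp⟩
  | pred n ih =>
    rw [zpow_sub_one₀ goldenRatio_ne_zero, zpow_sub_one₀ goldenConj_ne_zero]
    refine ih.mul ⟨-1, 1, ?_, ?_⟩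
    · rw [inv_goldenRatio]; push_cast; linarith
    · rw [inv_goldenConj]; push_cast; linarith

theorem Conj.sum (S : Finset ℤ) :
    Conj (∑ i ∈ S, goldenRatio ^ i) (∑ i ∈ S, goldenConj ^ i) := by
  induction S using Finset.induction_on with
  | empty => simpa using Conj.intCast 0
  | insert i S hi ih =>
    rw [Finset.sum_insert hi, Finset.sum_insert hi]
    exact (Conj.zpow i).add ih

/-- Bounds for conjugates of sums without consecutive exponents. -/
theorem conj_bound (n : ℕ) : ∀ (S : Finset ℤ) (k : ℤ), Legal S → (∀ i ∈ S, k ≤ i ∧ i < k + n) →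
    ∃ t : ℝ, -1 ≤ t ∧ t ≤ goldenRatio ∧ ∑ i ∈ S, goldenConj ^ i = goldenConj ^ k * t := by
  have hφ := goldenRatio_pos
  have hprod := goldenRatio_mul_goldenConj
  have hs := goldenRatio_add_goldenConj
  have hψ := goldenConj_neg
  have hψ2 := goldenConj_sq
  have hψ1 := neg_one_lt_goldenConj
  induction n using Nat.strong_induction_on with
  | _ n ih =>
    intro S k hS hk
    rcases Nat.eq_zero_or_pos n with rfl | hn
    · have : S = ∅ := by
        rw [Finset.eq_empty_iff_forall_notMem]
        intro i hi
        have := hk i hi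
        push_cast at this
        omega
      subst this
      exact ⟨0, by norm_num, hφ.le, by simp⟩
    by_cases hkS : k ∈ S
    · have hk1 := hS k hkS
      have hk' : ∀ i ∈ S.erase k, k + 2 ≤ i ∧ i < k + 2 + ((n - 2 : ℕ) : ℤ) := by
        intro i hi
        have h1 := hk i (Finset.mem_of_mem_erase hi)
        have h2 := Finset.ne_of_mem_erase hi
        have h3 : i ≠ k + 1 := fun h => hk1 (h ▸ Finset.mem_of_mem_erase hi)
        omega
      obtain ⟨t, ht1, ht2, ht⟩ := ih (n - 2) (by omega) (S.erase k) (k + 2)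
        (hS.mono (Finset.erase_subset _ _)) hk'
      refine ⟨1 + goldenConj ^ 2 * t, ?_, ?_, ?_⟩
      · nlinarith [sq_nonneg goldenConj]
      · nlinarith [sq_nonneg goldenConj]
      · rw [← Finset.add_sum_erase S _ hkS, ht, psi_zpow_add_two]; ring
    · have hk' : ∀ i ∈ S, k + 1 ≤ i ∧ i < k + 1 + ((n - 1 : ℕ) : ℤ) := by
        intro i hi
        have h1 := hk i hi
        have h3 : i ≠ k := fun h => hkS (h ▸ hi)
        omega
      obtain ⟨t, ht1, ht2, ht⟩ := ih (n - 1) (by omega) S (k + 1) hS hk'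
      refine ⟨goldenConj * t, ?_, ?_, ?_⟩
      · nlinarith
      · nlinarith
      · rw [ht, zpow_add_one₀ goldenConj_ne_zero]; ring

/-- Greedy expansion of a nonnegative real number down to the exponent `K - j`. -/
theorem greedy (x : ℝ) (hx : 0 ≤ x) (K : ℕ) (hK : x < goldenRatio ^ (K : ℤ)) (j : ℕ) :
    ∃ S : Finset ℤ, Legal S ∧ (∀ i ∈ S, (K : ℤ) - j ≤ i ∧ i < K) ∧
      0 ≤ x - ∑ i ∈ S, goldenRatio ^ i ∧
      x - ∑ i ∈ S, goldenRatio ^ i < goldenRatio ^ ((K : ℤ) - j) ∧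
      ((K : ℤ) - j ∈ S → x - ∑ i ∈ S, goldenRatio ^ i < goldenRatio ^ ((K : ℤ) - j - 1)) := by
  induction j with
  | zero => exact ⟨∅, by simp [Legal], by simp, by simpa using hx, by simpa using hK, by simp⟩
  | succ j ih =>
    obtain ⟨S, hS, hb, h0, h1, h2⟩ := ih
    set e : ℤ := (K : ℤ) - j with he
    have he' : (K : ℤ) - ((j + 1 : ℕ) : ℤ) = e - 1 := by push_cast; ring
    rw [he']
    have hnot : e - 1 ∉ S := fun h => by have := hb _ h; omega
    by_cases hr : goldenRatio ^ (e - 1) ≤ x - ∑ i ∈ S, goldenRatio ^ i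
    · have heS : e ∉ S := fun h => by have := h2 h; linarith
      have hp := phi_zpow_add_two (e - 2)
      rw [show e - 2 + 2 = e by ring, show e - 2 + 1 = e - 1 by ring] at hp
      have hlt : goldenRatio ^ (e - 2) < goldenRatio ^ (e - 1) :=
        zpow_lt_zpow_right₀ one_lt_goldenRatio (by omega)
      refine ⟨insert (e - 1) S, ?_, ?_, ?_, ?_, ?_⟩
      · intro i hi hi'
        rw [Finset.mem_insert] at hi hi'
        rcases hi with rfl | hi
        · rcases hi' with h | h
          · omega
          · rw [sub_add_cancel] at h; exact heS h
        · rcases hi' with h | h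
          · have := hb i hi; omega
          · exact hS i hi h
      · intro i hi
        rw [Finset.mem_insert] at hi
        rcases hi with rfl | hi
        · omega
        · have := hb i hi; omega
      · rw [Finset.sum_insert hnot]; linarith
      · rw [Finset.sum_insert hnot]; linarith
      · intro _
        rw [Finset.sum_insert hnot, show e - 1 - 1 = e - 2 by ring]; linarith
    · exact ⟨S, hS, fun i hi => by have := hb i hi; omega, h0, not_le.mp hr,
        fun h => absurd h hnot⟩

theorem exists_legal (N : ℕ) :
    ∃ S : Finset ℤ, Legal S ∧ (N : ℝ) = ∑ i ∈ S, goldenRatio ^ i := by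
  have hφ := goldenRatio_pos
  have hφ2 := goldenRatio_sq
  have h1φ := one_lt_goldenRatio
  have hs := goldenRatio_add_goldenConj
  have hψ := goldenConj_neg
  have hlo : (1.6 : ℝ) < goldenRatio := by nlinarith
  have hhi : goldenRatio < (1.62 : ℝ) := by nlinarith
  obtain ⟨K, hK⟩ := pow_unbounded_of_one_lt (N : ℝ) h1φ
  obtain ⟨m, hm⟩ : ∃ m : ℕ, |(N : ℝ) * goldenConj ^ m| < 1 / 10 := by
    have ht : Filter.Tendsto (fun m : ℕ => (N : ℝ) * goldenConj ^ m) Filter.atTop (nhds 0) := by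
      have := (tendsto_pow_atTop_nhds_zero_of_abs_lt_one (r := goldenConj)
        (by rw [abs_lt]; constructor <;> linarith)).const_mul (N : ℝ)
      simpa using this
    have := (Metric.tendsto_atTop.mp ht (1 / 10) (by norm_num))
    obtain ⟨m, hm⟩ := this
    refine ⟨m, ?_⟩
    have h := hm m le_rfl
    rwa [Real.dist_eq, sub_zero] at h
  obtain ⟨S, hS, hb, h0, h1, h2⟩ := greedy N (Nat.cast_nonneg N) K (by exact_mod_cast hK) (K + m)
  rw [show (K : ℤ) - ((K + m : ℕ) : ℤ) = -(m : ℤ) by push_cast; ring] at hb h1 h2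
  obtain ⟨t, ht1, ht2, ht⟩ := conj_bound (K + m) S (-(m : ℤ)) hS
    (fun i hi => by have := hb i hi; push_cast; omega)
  obtain ⟨a, b, ha, hb'⟩ := (((Conj.intCast N).sub (Conj.sum S)).mul (Conj.zpow m))
  have hφm : goldenRatio ^ (-(m : ℤ)) * goldenRatio ^ (m : ℤ) = 1 := by
    rw [← zpow_add₀ goldenRatio_ne_zero]; simp
  have hψm : goldenConj ^ (-(m : ℤ)) * goldenConj ^ (m : ℤ) = 1 := by
    rw [← zpow_add₀ goldenConj_ne_zero]; simp
  have hpos : 0 < goldenRatio ^ (m : ℤ) := zpow_pos hφ _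
  push_cast at ha hb'
  have hz0 : (0 : ℝ) ≤ a + b * goldenRatio := by rw [← ha]; positivity
  have hz1 : (a : ℝ) + b * goldenRatio < 1 := by
    rw [← ha, ← hφm]; exact mul_lt_mul_of_pos_right h1 hpos
  have hc : (a : ℝ) + b * goldenConj = N * goldenConj ^ m - t := by
    rw [← hb', ht, ← zpow_natCast]; linear_combination (-t) * hψm
  rw [abs_lt] at hm
  have hψe : goldenConj = 1 - goldenRatio := by linarith
  rw [hψe] at hc hm
  have hb0 : b = 0 ∨ b = 1 := by
    have hb1 : (-1 : ℝ) < b := by nlinarith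
    have hb2 : (b : ℝ) < 2 := by nlinarith
    have hb1 : -1 < b := by exact_mod_cast hb1
    have hb2 : b < 2 := by exact_mod_cast hb2
    omega
  rcases hb0 with rfl | rfl
  · have ha0 : a = 0 := by
      have h3 : (-1 : ℝ) < a := by push_cast at hz0; linarith
      have h4 : (a : ℝ) < 1 := by simpa using hz1
      have h3 : -1 < a := by exact_mod_cast h3
      have h4 : a < 1 := by exact_mod_cast h4
      omega
    subst ha0
    refine ⟨S, hS, ?_⟩
    have : ((N : ℝ) - ∑ i ∈ S, goldenRatio ^ i) = 0 := by
      have ha2 : ((N : ℝ) - ∑ i ∈ S, goldenRatio ^ i) * goldenRatio ^ (m : ℤ) = 0 := by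
        rw [ha]; push_cast; ring
      rcases mul_eq_zero.mp ha2 with h | h
      · exact h
      · exact absurd h hpos.ne'
    linarith
  · have ha1 : a = -1 := by
      have h3 : (-2 : ℝ) < a := by push_cast at hz0; linarith
      have h4 : (a : ℝ) < 0 := by push_cast at hz1; linarith
      have h3 : -2 < a := by exact_mod_cast h3
      have h4 : a < 0 := by exact_mod_cast h4
      omega
    subst ha1
    have hr : (N : ℝ) - ∑ i ∈ S, goldenRatio ^ i = goldenRatio ^ (-(m : ℤ) - 1) := by
      rw [zpow_sub_one₀ goldenRatio_ne_zero, inv_goldenRatio]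
      push_cast at ha
      linear_combination goldenRatio ^ (-(m : ℤ)) * ha
        - ((N : ℝ) - ∑ i ∈ S, goldenRatio ^ i) * hφm
        + goldenRatio ^ (-(m : ℤ)) * hs
    have hmS : -(m : ℤ) ∉ S := fun h => by have := h2 h; linarith
    have hnot : -(m : ℤ) - 1 ∉ S := fun h => by have := hb _ h; omega
    refine ⟨insert (-(m : ℤ) - 1) S, ?_, ?_⟩
    · intro i hi hi'
      rw [Finset.mem_insert] at hi hi'
      rcases hi with rfl | hi
      · rcases hi' with h | h
        · omega
        · rw [sub_add_cancel] at h; exact hmS h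
      · rcases hi' with h | h
        · have := hb i hi; omega
        · exact hS i hi h
    · rw [Finset.sum_insert hnot]; linarith

/-- The value of a `0`-`1` digit sequence is the sum of powers over its support. -/
theorem sum_eq_support (d : ℤ →₀ ℕ) (hd : ∀ i, d i = 0 ∨ d i = 1) :
    (d.sum fun i a => (a : ℝ) * goldenRatio ^ i) = ∑ i ∈ d.support, goldenRatio ^ i := by
  rw [Finsupp.sum]
  refine Finset.sum_congr rfl fun i hi => ?_
  rw [(hd i).resolve_left (Finsupp.mem_support_iff.mp hi)]
  simp

theorem legal_support {N : ℕ} {d : ℤ →₀ ℕ} (h : IsBasePhiExpansion N d) : Legal d.support := by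
  intro i hi hi'
  rw [Finsupp.mem_support_iff] at hi hi'
  exact h.no_consecutive i ⟨(h.digit i).resolve_left hi, (h.digit _).resolve_left hi'⟩

end BasePhi

/-- Every natural number has exactly one base phi expansion. -/
theorem existsUnique_isBasePhiExpansion (N : ℕ) : ∃! d : ℤ →₀ ℕ, IsBasePhiExpansion N d := by
  classical
  obtain ⟨S, hS, hN⟩ := BasePhi.exists_legal N
  have hval : ∀ i, (Finsupp.indicator S fun _ _ => 1 : ℤ →₀ ℕ) i = if i ∈ S then 1 else 0 := by
    intro i
    simp [Finsupp.indicator_apply]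
  have hex : IsBasePhiExpansion N (Finsupp.indicator S fun _ _ => 1) := by
    have hd : ∀ i, (Finsupp.indicator S fun _ _ => 1 : ℤ →₀ ℕ) i = 0 ∨
        (Finsupp.indicator S fun _ _ => 1 : ℤ →₀ ℕ) i = 1 := by
      intro i
      rw [hval]
      split_ifs <;> simp
    refine ⟨hd, ?_, ?_⟩
    · intro i
      rw [hval, hval]
      rintro ⟨h1, h2⟩
      have h1 : i ∈ S := by by_contra h; simp [h] at h1
      have h2 : i + 1 ∈ S := by by_contra h; simp [h] at h2
      exact hS i h1 h2
    · rw [BasePhi.sum_eq_support _ hd, hN]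
      congr 1
      ext i
      rw [Finsupp.mem_support_iff, hval]
      simp
  refine ⟨_, hex, fun d hd => ?_⟩
  generalize (Finsupp.indicator S fun _ _ => 1 : ℤ →₀ ℕ) = d' at hex
  have hsupp : d.support = d'.support := by
    refine BasePhi.unique_aux _ _ _ rfl (BasePhi.legal_support hd) (BasePhi.legal_support hex) ?_
    rw [← BasePhi.sum_eq_support _ hd.digit, ← BasePhi.sum_eq_support _ hex.digit, ← hd.sum_eq,
      ← hex.sum_eq]
  ext i
  have hi : d i ≠ 0 ↔ d' i ≠ 0 := by
    rw [← Finsupp.mem_support_iff, ← Finsupp.mem_support_iff, hsupp]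
  have h1 := hd.digit i
  have h2 := hex.digit i
  omega

/-- The digits of the base phi expansion of `N`. -/
noncomputable def basePhi (N : ℕ) : ℤ →₀ ℕ :=
  (existsUnique_isBasePhiExpansion N).choose

/-- The sum of digits function `s_β` of base phi expansions. -/
noncomputable def sBeta (N : ℕ) : ℕ :=
  (basePhi N).sum fun _ a => a

/-! ## Points of increase, constancy and decrease; generalized Beatty sequences -/

/-- First differences of a function on the natural numbers. -/
def firstDiff (f : ℕ → ℕ) (N : ℕ) : ℤ :=
  (f (N + 1) : ℤ) - (f N : ℤ)

/-- Points of increase of `f`. -/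
def pointsOfIncrease (f : ℕ → ℕ) : Set ℕ := {N | 0 < firstDiff f N}

/-- Points of constancy of `f`. -/
def pointsOfConstancy (f : ℕ → ℕ) : Set ℕ := {N | firstDiff f N = 0}

/-- Points of decrease of `f`. -/
def pointsOfDecrease (f : ℕ → ℕ) : Set ℕ := {N | firstDiff f N < 0}

/-- The generalized Beatty sequence `V(n) = p ⌊n φ⌋ + q n + r` with parameters `(p, q, r)`. -/
noncomputable def gbs (p q r : ℤ) (n : ℕ) : ℤ :=
  p * ⌊(n : ℝ) * Real.goldenRatio⌋ + q * n + r

/-- The set of terms of the generalized Beatty sequence with parameters `(p, q, r)`, with the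
index running over all `n ≥ n₀`. -/
def gbsTerms (p q r : ℤ) (n₀ : ℕ) : Set ℤ :=
  {v | ∃ n : ℕ, n₀ ≤ n ∧ v = gbs p q r n}

/-! ### Carries when a power of φ is added -/

namespace BasePhi

open Real

/-! Split the expansion of `N` at the radix point: P holds the exponents ≥ 0 and M the negative
ones. Write Σ_P φ^i = a + bφ. Then t = Σ_M φ^i equals c - bφ with c = N - a, and the conjugate x =
Σ_P ψ^i = a + bψ differs from t by an integer j. This gives N = 2c - b + j, and the sign of the
first difference can be read off from (j, t).

Adding 1 either fills position 0 or uses one of 1 + φ = φ², 1 + φ⁻¹ = φ, 2 = φ + φ⁻². A few digits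
around the radix point decide whether the resulting carries create or destroy digits. Fixing the low
digits of P confines x to an interval, and fixing the high digits of M confines t. Since x = t + j,
the two sides restrict each other: j is forced, some digit patterns are excluded, and each remaining
pattern puts t in an explicit window (`exists_signMatches`). Conversely (b, c, j) is determined by N
(`coords_unique`), so the windows characterize the sign.

Each Beatty sequence belongs to a window of length φ^(-k) with an endpoint in ℤ[φ]. As ψ^k is a
unit, an affine bijection of ℤ² turns the condition that c - bφ lies in the window into nφ - m ∈ [0,
1), that is m = ⌊nφ⌋, and turns 2c - b + j into pm + qn + r (`mem_gbsTerms_zero_iff_inWindow`,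
`mem_gbsTerms_one_iff_inWindow`). -/

theorem legal_union {P M : Finset ℤ} (hP : Legal P) (hM : Legal M)
    (h : ∀ p ∈ P, ∀ m ∈ M, m + 1 < p) : Legal (P ∪ M) := by
  intro i hi hi'
  rw [Finset.mem_union] at hi hi'
  rcases hi with hi | hi <;> rcases hi' with hi' | hi'
  · exact hP i hi hi'
  · have := h _ hi _ hi'; omega
  · have := h _ hi' _ hi; omega
  · exact hM i hi hi'

theorem disjoint_of_gap {P M : Finset ℤ} (h : ∀ p ∈ P, ∀ m ∈ M, m + 1 < p) : Disjoint P M :=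
  Finset.disjoint_left.mpr fun i hi hi' => by have := h i hi i hi'; omega

theorem legal_insert {S : Finset ℤ} {k : ℤ} (hS : Legal S) (h1 : k + 1 ∉ S) (h2 : k - 1 ∉ S) :
    Legal (insert k S) := by
  intro i hi hi'
  rw [Finset.mem_insert] at hi hi'
  rcases hi with rfl | hi
  · rcases hi' with h | h
    · omega
    · exact h1 h
  · rcases hi' with h | h
    · exact h2 (by rwa [← h, add_sub_cancel_right])
    · exact hS i hi h

theorem two_mul_phi_zpow (k : ℤ) :
    2 * goldenRatio ^ k = goldenRatio ^ (k + 1) + goldenRatio ^ (k - 2) := by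
  have h1 := phi_zpow_add_two (k - 1)
  have h2 := phi_zpow_add_two (k - 2)
  rw [show k - 1 + 2 = k + 1 by ring, show k - 1 + 1 = k by ring] at h1
  rw [show k - 2 + 2 = k by ring, show k - 2 + 1 = k - 1 by ring] at h2
  linarith

/-- Adding `φ ^ k` to an expansion with exponents greater than `k` carries upwards. -/
theorem exists_legal_add_of_lt (n : ℕ) : ∀ (S : Finset ℤ) (k : ℤ), S.card = n → Legal S →
    (∀ i ∈ S, k < i) → ∃ T : Finset ℤ, Legal T ∧ (∀ i ∈ T, k ≤ i) ∧
      ∑ i ∈ T, goldenRatio ^ i = ∑ i ∈ S, goldenRatio ^ i + goldenRatio ^ k ∧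
      (k + 1 ∉ S → T.card = S.card + 1) ∧ (k + 1 ∈ S → T.card ≤ S.card) ∧
      (k + 1 ∈ S → k + 3 ∉ S → T.card = S.card) ∧
      (k + 1 ∈ S → k + 3 ∈ S → T.card < S.card) := by
  induction n using Nat.strong_induction_on with
  | _ n ih =>
    intro S k hc hS hk
    by_cases h1 : k + 1 ∈ S
    · have hcard := Finset.card_erase_add_one h1
      -- φ^k + φ^(k+1) = φ^(k+2), and k+2 is free, so the carry moves to k+2. One digit is lost
      -- here; the recursive step restores it exactly when k+3 is absent.
      obtain ⟨T, hT, hTk, hsum, hT1, hT2, -, -⟩ := ih (S.erase (k + 1)).card (by omega)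
        (S.erase (k + 1)) (k + 2) rfl (hS.mono (Finset.erase_subset _ _)) (by
          intro i hi
          have h2 := hk i (Finset.mem_of_mem_erase hi)
          have h3 := Finset.ne_of_mem_erase hi
          have h4 : i ≠ k + 1 + 1 := fun h => hS _ h1 (h ▸ Finset.mem_of_mem_erase hi)
          omega)
      have h3 : k + 2 + 1 ∈ S.erase (k + 1) ↔ k + 3 ∈ S := by
        rw [Finset.mem_erase, show k + 2 + 1 = k + 3 by ring]
        exact ⟨fun h => h.2, fun h => ⟨by omega, h⟩⟩
      rw [h3] at hT1 hT2
      refine ⟨T, hT, fun i hi => by have := hTk i hi; omega, ?_, fun h => absurd h1 h, ?_, ?_, ?_⟩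
      · rw [hsum, ← Finset.add_sum_erase S _ h1, phi_zpow_add_two]; ring
      · intro _
        by_cases h : k + 3 ∈ S
        · have := hT2 h; omega
        · have := hT1 h; omega
      · intro _ h
        have := hT1 h; omega
      · intro _ h
        have := hT2 h; omega
    · have h0 : k ∉ S := fun h => by have := hk k h; omega
      refine ⟨insert k S, legal_insert hS h1 fun h => by have := hk _ h; omega, ?_, ?_, ?_,
        fun h => absurd h h1, fun h => absurd h h1, fun h => absurd h h1⟩
      · intro i hi
        rw [Finset.mem_insert] at hi
        rcases hi with rfl | hi
        · rfl
        · exact (hk i hi).le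
      · rw [Finset.sum_insert h0, add_comm]
      · exact fun _ => Finset.card_insert_of_notMem h0

/-- Adding `φ ^ k` to an expansion with exponents at most `k` carries downwards. -/
theorem exists_legal_add_of_le (n : ℕ) : ∀ (S : Finset ℤ) (k : ℤ), S.card = n → Legal S →
    (∀ i ∈ S, i ≤ k) → ∃ T : Finset ℤ, Legal T ∧ (∀ i ∈ T, i ≤ k + 1) ∧
      ∑ i ∈ T, goldenRatio ^ i = ∑ i ∈ S, goldenRatio ^ i + goldenRatio ^ k ∧
      T.card ≤ S.card + 1 ∧ (k ∉ S → k - 1 ∉ S → T.card = S.card + 1) ∧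
      (k ∉ S → k - 1 ∈ S → T.card = S.card) ∧
      (k ∈ S → k - 2 ∉ S → k - 3 ∉ S → T.card = S.card + 1) := by
  induction n using Nat.strong_induction_on with
  | _ n ih =>
    intro S k hc hS hk
    by_cases h0 : k ∈ S
    · have hcard := Finset.card_erase_add_one h0
      -- 2φ^k = φ^(k+1) + φ^(k-2): what remains of S lies at or below k-2, so the recursion reaches
      -- at most k-1 and k+1 can be inserted.
      obtain ⟨T, hT, hTk, hsum, hT1, hT2, -, -⟩ := ih (S.erase k).card (by omega)
        (S.erase k) (k - 2) rfl (hS.mono (Finset.erase_subset _ _)) (by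
          intro i hi
          have h2 := hk i (Finset.mem_of_mem_erase hi)
          have h3 := Finset.ne_of_mem_erase hi
          have h4 : i ≠ k - 1 := fun h => hS _ (Finset.mem_of_mem_erase hi) (by
            rwa [h, sub_add_cancel])
          omega)
      have hnot : k + 1 ∉ T := fun h => by have := hTk _ h; omega
      have hins := Finset.card_insert_of_notMem hnot
      refine ⟨insert (k + 1) T, legal_insert hT (fun h => by have := hTk _ h; omega)
        (fun h => by have := hTk _ h; omega), ?_, ?_, by omega, fun h => absurd h0 h,
        fun h => absurd h0 h, ?_⟩
      · intro i hi
        rw [Finset.mem_insert] at hi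
        rcases hi with rfl | hi
        · rfl
        · have := hTk i hi; omega
      · rw [Finset.sum_insert hnot, hsum, ← Finset.add_sum_erase S _ h0]
        linarith [two_mul_phi_zpow k]
      · intro _ h2 h3
        have := hT2 (fun h => h2 (Finset.mem_of_mem_erase h)) (fun h => h3 (by
          have := Finset.mem_of_mem_erase h
          rwa [show k - 2 - 1 = k - 3 by ring] at this))
        omega
    · by_cases h1 : k - 1 ∈ S
      · have hcard := Finset.card_erase_add_one h1
        have hlt : ∀ i ∈ S.erase (k - 1), i ≤ k - 3 := by
          intro i hi
          have h2 := hk i (Finset.mem_of_mem_erase hi)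
          have h3 := Finset.ne_of_mem_erase hi
          have h4 : i ≠ k := fun h => h0 (h ▸ Finset.mem_of_mem_erase hi)
          have h5 : i + 1 ≠ k - 1 := fun h => hS _ (Finset.mem_of_mem_erase hi) (h ▸ h1)
          omega
        have hnot : k + 1 ∉ S.erase (k - 1) := fun h => by have := hlt _ h; omega
        have hins := Finset.card_insert_of_notMem hnot
        -- φ^k + φ^(k-1) = φ^(k+1) trades one digit for another and ends the carry.
        refine ⟨insert (k + 1) (S.erase (k - 1)), legal_insert (hS.mono (Finset.erase_subset _ _))
          (fun h => by have := hlt _ h; omega) (fun h => by have := hlt _ h; omega), ?_, ?_,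
          by omega, fun _ h => absurd h1 h, fun _ _ => by omega, fun h => absurd h h0⟩
        · intro i hi
          rw [Finset.mem_insert] at hi
          rcases hi with rfl | hi
          · rfl
          · have := hlt i hi; omega
        · rw [Finset.sum_insert hnot, ← Finset.add_sum_erase S _ h1]
          have h2 := phi_zpow_add_two (k - 1)
          rw [show k - 1 + 2 = k + 1 by ring, show k - 1 + 1 = k by ring] at h2
          linarith
      · refine ⟨insert k S, legal_insert hS (fun h => by have := hk _ h; omega) h1, ?_, ?_,
          (Finset.card_insert_of_notMem h0).le, fun _ _ => Finset.card_insert_of_notMem h0,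
          fun _ h => absurd h h1, fun h => absurd h h0⟩
        · intro i hi
          rw [Finset.mem_insert] at hi
          rcases hi with rfl | hi
          · omega
          · have := hk i hi; omega
        · rw [Finset.sum_insert h0, add_comm]

/-! ### Conjugate bounds and digit counts -/

/-- Strict bounds for conjugates of sums without consecutive exponents. -/
theorem exists_conj_sum_eq (n : ℕ) : ∀ (S : Finset ℤ) (k : ℤ), Legal S →
    (∀ i ∈ S, k ≤ i ∧ i < k + n) →
    ∃ y : ℝ, -1 < y ∧ y < goldenRatio ∧ ∑ i ∈ S, goldenConj ^ i = goldenConj ^ k * y := by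
  have hφ := goldenRatio_pos
  have hprod := goldenRatio_mul_goldenConj
  have hs := goldenRatio_add_goldenConj
  have hψ := goldenConj_neg
  have hψ2 := goldenConj_sq
  have hψ1 := neg_one_lt_goldenConj
  induction n using Nat.strong_induction_on with
  | _ n ih =>
    intro S k hS hk
    rcases Nat.eq_zero_or_pos n with rfl | hn
    · have : S = ∅ := by
        rw [Finset.eq_empty_iff_forall_notMem]
        intro i hi
        have := hk i hi
        push_cast at this
        omega
      subst this
      exact ⟨0, by norm_num, hφ, by simp⟩
    by_cases hkS : k ∈ S
    · have hk1 := hS k hkS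
      obtain ⟨y, hy1, hy2, hy⟩ := ih (n - 2) (by omega) (S.erase k) (k + 2)
        (hS.mono (Finset.erase_subset _ _)) (by
          intro i hi
          have h1 := hk i (Finset.mem_of_mem_erase hi)
          have h2 := Finset.ne_of_mem_erase hi
          have h3 : i ≠ k + 1 := fun h => hk1 (h ▸ Finset.mem_of_mem_erase hi)
          omega)
      -- A digit at k acts on y by y ↦ 1 + ψ²y, its absence by y ↦ ψy. Both maps send the open
      -- interval (-1, φ) into itself because ψφ = -1 and 1 + ψ²φ = φ; its endpoints are approached
      -- by the alternating digit patterns.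
      refine ⟨1 + goldenConj ^ 2 * y, ?_, ?_, ?_⟩
      · nlinarith [sq_nonneg goldenConj]
      · nlinarith [sq_nonneg goldenConj]
      · rw [← Finset.add_sum_erase S _ hkS, hy, psi_zpow_add_two]; ring
    · obtain ⟨y, hy1, hy2, hy⟩ := ih (n - 1) (by omega) S (k + 1) hS (by
        intro i hi
        have h1 := hk i hi
        have h3 : i ≠ k := fun h => hkS (h ▸ hi)
        omega)
      refine ⟨goldenConj * y, by nlinarith, by nlinarith, ?_⟩
      rw [hy, zpow_add_one₀ goldenConj_ne_zero]; ring

theorem exists_conj_sum_eq_of_le {S : Finset ℤ} (hS : Legal S) {k : ℤ} (hk : ∀ i ∈ S, k ≤ i) :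
    ∃ y : ℝ, -1 < y ∧ y < goldenRatio ∧ ∑ i ∈ S, goldenConj ^ i = goldenConj ^ k * y := by
  obtain ⟨B, hB⟩ := S.bddAbove
  refine exists_conj_sum_eq (B + 1 - k).toNat S k hS fun i hi => ⟨hk i hi, ?_⟩
  have h1 := hk i hi
  have h2 : i ≤ B := hB hi
  omega

theorem sBeta_eq_card {N : ℕ} {S : Finset ℤ} (hS : Legal S)
    (h : (N : ℝ) = ∑ i ∈ S, goldenRatio ^ i) : sBeta N = S.card := by
  have hd : IsBasePhiExpansion N (basePhi N) := (existsUnique_isBasePhiExpansion N).choose_spec.1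
  have hsupp : (basePhi N).support = S := by
    refine unique_aux _ _ _ rfl (legal_support hd) hS ?_
    rw [← sum_eq_support _ hd.digit, ← hd.sum_eq, h]
  rw [sBeta, Finsupp.sum, ← hsupp, Finset.card_eq_sum_ones]
  exact Finset.sum_congr rfl fun i hi => (hd.digit i).resolve_left (Finsupp.mem_support_iff.mp hi)

theorem sBeta_eq_card_add_card {N : ℕ} {P M : Finset ℤ} (hP : Legal P) (hM : Legal M)
    (hPM : ∀ p ∈ P, ∀ m ∈ M, m + 1 < p)
    (h : (N : ℝ) = ∑ i ∈ P, goldenRatio ^ i + ∑ i ∈ M, goldenRatio ^ i) :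
    sBeta N = P.card + M.card := by
  rw [sBeta_eq_card (legal_union hP hM hPM), Finset.card_union_of_disjoint (disjoint_of_gap hPM)]
  rw [h, Finset.sum_union (disjoint_of_gap hPM)]

/-! ### Windows for the sign of the first difference -/

/-- Location of the points of increase in the cut-and-project coordinates `(j, t)`. -/
def IncreaseRegion (j : ℤ) (t : ℝ) : Prop :=
  (j = 0 ∧ 0 ≤ t ∧ t < goldenRatio - 1) ∨ (j = 1 ∧ 0 ≤ t ∧ t < 2 * goldenRatio - 3)

/-- Location of the points of constancy in the cut-and-project coordinates `(j, t)`. -/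
def ConstancyRegion (j : ℤ) (t : ℝ) : Prop :=
  (j = -1 ∧ 2 * goldenRatio - 3 < t ∧ t < goldenRatio - 1) ∨
    (j = -1 ∧ goldenRatio - 1 < t ∧ t < 1) ∨
    (j = 1 ∧ 2 - goldenRatio ≤ t ∧ t < 4 * goldenRatio - 6)

/-- Location of the points of decrease in the cut-and-project coordinates `(j, t)`. -/
def DecreaseRegion (j : ℤ) (t : ℝ) : Prop :=
  (j = -1 ∧ 0 < t ∧ t < 2 * goldenRatio - 3) ∨
    (j = 1 ∧ 2 * goldenRatio - 3 < t ∧ t < 2 - goldenRatio) ∨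
    (j = 1 ∧ 4 * goldenRatio - 6 < t ∧ t < goldenRatio - 1)

/-- The trichotomy of the first difference of `s_β` at `N`, matched with the regions. -/
def SignMatches (N : ℕ) (j : ℤ) (t : ℝ) : Prop :=
  (0 < firstDiff sBeta N ∧ IncreaseRegion j t) ∨
    (firstDiff sBeta N = 0 ∧ ConstancyRegion j t) ∨
    (firstDiff sBeta N < 0 ∧ DecreaseRegion j t)

theorem lt_goldenRatio_of_decimal : (1.61 : ℝ) < goldenRatio := by
  nlinarith [goldenRatio_sq, goldenRatio_pos]

theorem goldenRatio_lt_of_decimal : goldenRatio < (1.62 : ℝ) := by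
  nlinarith [goldenRatio_sq, one_lt_goldenRatio]

theorem phi_zpow_neg_one : goldenRatio ^ (-1 : ℤ) = goldenRatio - 1 := by
  have h := phi_zpow_add_two (-1)
  norm_num at h ⊢
  linarith

theorem phi_zpow_neg_two : goldenRatio ^ (-2 : ℤ) = 2 - goldenRatio := by
  have h := phi_zpow_add_two (-2)
  rw [show (-2 : ℤ) + 1 = -1 by norm_num, phi_zpow_neg_one, neg_add_cancel, zpow_zero] at h
  linarith

theorem phi_zpow_neg_three : goldenRatio ^ (-3 : ℤ) = 2 * goldenRatio - 3 := by
  have h := phi_zpow_add_two (-3)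
  rw [show (-3 : ℤ) + 1 = -2 by norm_num, show (-3 : ℤ) + 2 = -1 by norm_num,
    phi_zpow_neg_one, phi_zpow_neg_two] at h
  linarith

theorem phi_zpow_neg_four : goldenRatio ^ (-4 : ℤ) = 5 - 3 * goldenRatio := by
  have h := phi_zpow_add_two (-4)
  rw [show (-4 : ℤ) + 1 = -3 by norm_num, show (-4 : ℤ) + 2 = -2 by norm_num,
    phi_zpow_neg_three, phi_zpow_neg_two] at h
  linarith

theorem phi_zpow_neg_five : goldenRatio ^ (-5 : ℤ) = 5 * goldenRatio - 8 := by
  have h := phi_zpow_add_two (-5)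
  rw [show (-5 : ℤ) + 1 = -4 by norm_num, show (-5 : ℤ) + 2 = -3 by norm_num,
    phi_zpow_neg_three, phi_zpow_neg_four] at h
  linarith

theorem goldenConj_eq : goldenConj = 1 - goldenRatio := by
  linarith [goldenRatio_add_goldenConj]

theorem psi_zpow_two : goldenConj ^ (2 : ℤ) = 2 - goldenRatio := by
  rw [goldenConj_eq]; norm_cast; linear_combination goldenRatio_sq

theorem psi_zpow_add (k : ℤ) : goldenConj ^ (k + 2) = goldenConj ^ k * (2 - goldenRatio) := by
  rw [zpow_add₀ goldenConj_ne_zero, psi_zpow_two]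

theorem psi_zpow_three : goldenConj ^ (3 : ℤ) = 3 - 2 * goldenRatio := by
  rw [show (3 : ℤ) = 1 + 2 by norm_num, psi_zpow_add, zpow_one, goldenConj_eq]
  linear_combination goldenRatio_sq

theorem psi_zpow_four : goldenConj ^ (4 : ℤ) = 5 - 3 * goldenRatio := by
  rw [show (4 : ℤ) = 2 + 2 by norm_num, psi_zpow_add, psi_zpow_two]
  linear_combination goldenRatio_sq

theorem psi_zpow_five : goldenConj ^ (5 : ℤ) = 8 - 5 * goldenRatio := by
  rw [show (5 : ℤ) = 3 + 2 by norm_num, psi_zpow_add, psi_zpow_three]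
  linear_combination 2 * goldenRatio_sq

theorem psi_zpow_six : goldenConj ^ (6 : ℤ) = 13 - 8 * goldenRatio := by
  rw [show (6 : ℤ) = 4 + 2 by norm_num, psi_zpow_add, psi_zpow_four]
  linear_combination 3 * goldenRatio_sq

/-- Bounds for a conjugate sum whose smallest possible exponent `k` has `ψ ^ k = u > 0`. -/
theorem conj_sum_bounds_of_pos {S : Finset ℤ} (hS : Legal S) {k : ℤ} (hk : ∀ i ∈ S, k ≤ i)
    {u : ℝ} (hu : goldenConj ^ k = u) (h0 : 0 < u) :
    -u < ∑ i ∈ S, goldenConj ^ i ∧ ∑ i ∈ S, goldenConj ^ i < u * goldenRatio := by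
  obtain ⟨y, h1, h2, h⟩ := exists_conj_sum_eq_of_le hS hk
  rw [h, hu]
  exact ⟨by nlinarith, by nlinarith⟩

/-- Bounds for a conjugate sum whose smallest possible exponent `k` has `ψ ^ k = u < 0`. -/
theorem conj_sum_bounds_of_neg {S : Finset ℤ} (hS : Legal S) {k : ℤ} (hk : ∀ i ∈ S, k ≤ i)
    {u : ℝ} (hu : goldenConj ^ k = u) (h0 : u < 0) :
    u * goldenRatio < ∑ i ∈ S, goldenConj ^ i ∧ ∑ i ∈ S, goldenConj ^ i < -u := by
  obtain ⟨y, h1, h2, h⟩ := exists_conj_sum_eq_of_le hS hk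
  rw [h, hu]
  exact ⟨by nlinarith, by nlinarith⟩

theorem zpow_le_sum {M : Finset ℤ} {i : ℤ} (hi : i ∈ M) :
    goldenRatio ^ i ≤ ∑ i ∈ M, goldenRatio ^ i :=
  Finset.single_le_sum (f := fun i : ℤ => goldenRatio ^ i)
    (fun i _ => (zpow_pos goldenRatio_pos i).le) hi

/-- Exponents left after removing the least possible one. -/
theorem le_of_mem_erase {S : Finset ℤ} (hS : Legal S) {k : ℤ} (hk : ∀ i ∈ S, k ≤ i)
    (h : k ∈ S) : ∀ i ∈ S.erase k, k + 2 ≤ i := by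
  intro i hi
  have h1 := hk i (Finset.mem_of_mem_erase hi)
  have h2 := Finset.ne_of_mem_erase hi
  have h3 : i ≠ k + 1 := fun h' => hS _ h (h' ▸ Finset.mem_of_mem_erase hi)
  omega

theorem le_of_notMem {S : Finset ℤ} {k : ℤ} (hk : ∀ i ∈ S, k ≤ i) (h : k ∉ S) :
    ∀ i ∈ S, k + 1 ≤ i := by
  intro i hi
  have h1 := hk i hi
  have h2 : i ≠ k := fun h' => h (h' ▸ hi)
  omega

/-! ### Effect of adding 1, by the digits at -1, 0 and 1 -/

section Cases

variable {N : ℕ} {P M : Finset ℤ} {j : ℤ}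

/-- Position 0 and both its neighbours are free, so adding 1 inserts a single digit. -/
theorem signMatches_of_notMem (hP : Legal P) (hM : Legal M) (hP0 : ∀ i ∈ P, 0 ≤ i)
    (hM0 : ∀ i ∈ M, i < 0)
    (hN : (N : ℝ) = ∑ i ∈ P, goldenRatio ^ i + ∑ i ∈ M, goldenRatio ^ i)
    (hj : ∑ i ∈ P, goldenConj ^ i = ∑ i ∈ M, goldenRatio ^ i + j)
    (h0 : 0 ∉ P) (h1 : 1 ∉ P) (hm : -1 ∉ M) :
    SignMatches N j (∑ i ∈ M, goldenRatio ^ i) := by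
  have hlo := lt_goldenRatio_of_decimal
  have hhi := goldenRatio_lt_of_decimal
  have hφ2 := goldenRatio_sq
  have hP2 : ∀ i ∈ P, (2 : ℤ) ≤ i := le_of_notMem (le_of_notMem hP0 h0) (by simpa using h1)
  have hM1 : ∀ i ∈ M, i < -1 := fun i hi => by
    have := hM0 i hi
    have h : i ≠ -1 := fun h => hm (h ▸ hi)
    omega
  have ht0 : 0 ≤ ∑ i ∈ M, goldenRatio ^ i :=
    Finset.sum_nonneg fun i _ => (zpow_pos goldenRatio_pos i).le
  have ht1 := sum_lt _ M (-1) rfl hM hM1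
  rw [phi_zpow_neg_one] at ht1
  obtain ⟨hx1, hx2⟩ := conj_sum_bounds_of_pos hP hP2 psi_zpow_two (by linarith)
  rw [hj] at hx1 hx2
  -- x ∈ (-ψ², φ - 1) and t ∈ [0, φ - 1) leave x - t in (-1, 1).
  have hj0 : j = 0 := by
    have h3 : (-1 : ℝ) < j := by linarith
    have h4 : (j : ℝ) < 1 := by nlinarith
    have h3 : -1 < j := by exact_mod_cast h3
    have h4 : j < 1 := by exact_mod_cast h4
    omega
  refine Or.inl ⟨?_, Or.inl ⟨hj0, ht0, ht1⟩⟩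
  have hs := sBeta_eq_card_add_card hP hM (fun p hp m hm => by
    have := hP2 p hp; have := hM1 m hm; omega) hN
  have hs' := sBeta_eq_card_add_card (N := N + 1) (P := insert 0 P) (M := M)
    (legal_insert hP (by simpa using h1) fun h => by have := hP2 _ h; omega) hM
    (fun p hp m hm => by
      rw [Finset.mem_insert] at hp
      have := hM1 m hm
      rcases hp with rfl | hp
      · omega
      · have := hP2 p hp; omega)
    (by rw [Finset.sum_insert h0]; push_cast; rw [hN, zpow_zero]; ring)
  rw [Finset.card_insert_of_notMem h0] at hs'
  unfold firstDiff
  omega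

/-- The carry 1 + φ = φ² keeps the digit count if 3 is free and lowers it if 3 is occupied. Under
the conjugate map the digit at 3 separates the windows of t = x + 1 at 2φ - 3. -/
theorem signMatches_of_one_mem (hP : Legal P) (hM : Legal M) (hP0 : ∀ i ∈ P, 0 ≤ i)
    (hM0 : ∀ i ∈ M, i < 0)
    (hN : (N : ℝ) = ∑ i ∈ P, goldenRatio ^ i + ∑ i ∈ M, goldenRatio ^ i)
    (hj : ∑ i ∈ P, goldenConj ^ i = ∑ i ∈ M, goldenRatio ^ i + j) (h1 : 1 ∈ P) :
    SignMatches N j (∑ i ∈ M, goldenRatio ^ i) := by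
  have hlo := lt_goldenRatio_of_decimal
  have hhi := goldenRatio_lt_of_decimal
  have hφ2 := goldenRatio_sq
  have h0 : 0 ∉ P := fun h => hP 0 h (by simpa using h1)
  have hP1 : ∀ i ∈ P, (1 : ℤ) ≤ i := le_of_notMem hP0 h0
  have hQ := hP.mono (Finset.erase_subset 1 P)
  have hP3 : ∀ i ∈ P.erase 1, (3 : ℤ) ≤ i := le_of_mem_erase hP hP1 h1
  have ht0 : 0 ≤ ∑ i ∈ M, goldenRatio ^ i :=
    Finset.sum_nonneg fun i _ => (zpow_pos goldenRatio_pos i).le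
  have ht1 := sum_lt _ M 0 rfl hM hM0
  rw [zpow_zero] at ht1
  have hxe := Finset.add_sum_erase P (fun i => goldenConj ^ i) h1
  simp only [zpow_one] at hxe
  obtain ⟨hx1, hx2⟩ := conj_sum_bounds_of_neg hQ hP3 psi_zpow_three (by linarith)
  rw [goldenConj_eq] at hxe
  rw [goldenConj_eq] at hj hx1 hx2
  -- x ∈ (-1, φ - 2) and t ∈ [φ - 1, 1) would place j strictly between -2 and -1.
  have hm : -1 ∉ M := by
    intro hm
    have h2 := zpow_le_sum hm
    rw [phi_zpow_neg_one] at h2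
    have h3 : (-2 : ℝ) < j := by nlinarith
    have h4 : (j : ℝ) < -1 := by nlinarith
    have h3 : -2 < j := by exact_mod_cast h3
    have h4 : j < -1 := by exact_mod_cast h4
    omega
  have hM1 : ∀ i ∈ M, i < -1 := fun i hi => by
    have := hM0 i hi
    have h : i ≠ -1 := fun h => hm (h ▸ hi)
    omega
  have ht1' := sum_lt _ M (-1) rfl hM hM1
  rw [phi_zpow_neg_one] at ht1'
  have hj0 : j = -1 := by
    have h3 : (-2 : ℝ) < j := by nlinarith
    have h4 : (j : ℝ) < 0 := by nlinarith
    have h3 : -2 < j := by exact_mod_cast h3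
    have h4 : j < 0 := by exact_mod_cast h4
    omega
  have hj1 : (j : ℝ) = -1 := by rw [hj0]; norm_num
  have hs := sBeta_eq_card_add_card hP hM (fun p hp m hm => by
    have := hP1 p hp; have := hM1 m hm; omega) hN
  obtain ⟨T, hT, hT0, hsum, -, -, hT1, hT2⟩ := exists_legal_add_of_lt _ P 0 rfl hP
    (fun i hi => by have := hP1 i hi; omega)
  have hs' := sBeta_eq_card_add_card (N := N + 1) hT hM (fun p hp m hm => by
    have := hT0 p hp; have := hM1 m hm; omega) (by
    rw [hsum]; push_cast; rw [hN, zpow_zero]; ring)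
  by_cases h3 : 3 ∈ P
  · have h3' : (3 : ℤ) ∈ P.erase 1 := Finset.mem_erase.mpr ⟨by norm_num, h3⟩
    have hxe' := Finset.add_sum_erase (P.erase 1) (fun i => goldenConj ^ i) h3'
    obtain ⟨hx3, hx4⟩ := conj_sum_bounds_of_neg (hQ.mono (Finset.erase_subset 3 _))
      (le_of_mem_erase hQ hP3 h3' : ∀ i ∈ (P.erase 1).erase 3, (5 : ℤ) ≤ i) psi_zpow_five
      (by linarith)
    simp only [psi_zpow_three] at hxe'
    rw [goldenConj_eq] at hxe' hx3 hx4
    refine Or.inr (Or.inr ⟨?_, Or.inl ⟨hj0, by nlinarith, by nlinarith⟩⟩)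
    have := hT2 (by simpa using h1) (by simpa using h3)
    unfold firstDiff
    omega
  · obtain ⟨hx3, hx4⟩ := conj_sum_bounds_of_pos hQ
      (le_of_notMem hP3 (fun h => h3 (Finset.mem_of_mem_erase h)) :
        ∀ i ∈ P.erase 1, (4 : ℤ) ≤ i) psi_zpow_four (by linarith)
    rw [goldenConj_eq] at hx3 hx4
    refine Or.inr (Or.inl ⟨?_, Or.inl ⟨hj0, by nlinarith, by nlinarith⟩⟩)
    have := hT1 (by simpa using h1) (by simpa using h3)
    unfold firstDiff
    omega

/-- 1 + φ⁻¹ = φ moves the digit at -1 to position 1, leaving the count unchanged. This needs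
position 2 to be free, which the conjugate bound guarantees. -/
theorem signMatches_of_neg_one_mem (hP : Legal P) (hM : Legal M) (hP0 : ∀ i ∈ P, 0 ≤ i)
    (hM0 : ∀ i ∈ M, i < 0)
    (hN : (N : ℝ) = ∑ i ∈ P, goldenRatio ^ i + ∑ i ∈ M, goldenRatio ^ i)
    (hj : ∑ i ∈ P, goldenConj ^ i = ∑ i ∈ M, goldenRatio ^ i + j)
    (h0 : 0 ∉ P) (h1 : 1 ∉ P) (hm : -1 ∈ M) :
    SignMatches N j (∑ i ∈ M, goldenRatio ^ i) := by
  have hlo := lt_goldenRatio_of_decimal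
  have hhi := goldenRatio_lt_of_decimal
  have hφ2 := goldenRatio_sq
  have hP2 : ∀ i ∈ P, (2 : ℤ) ≤ i := le_of_notMem (le_of_notMem hP0 h0) (by simpa using h1)
  have ht0 := zpow_le_sum hm
  have ht1 := sum_lt _ M 0 rfl hM hM0
  rw [zpow_zero] at ht1
  rw [phi_zpow_neg_one] at ht0
  obtain ⟨hx1, hx2⟩ := conj_sum_bounds_of_pos hP hP2 psi_zpow_two (by linarith)
  have hj0 : j = -1 := by
    have h3 : (-2 : ℝ) < j := by linarith
    have h4 : (j : ℝ) < 0 := by nlinarith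
    have h3 : -2 < j := by exact_mod_cast h3
    have h4 : j < 0 := by exact_mod_cast h4
    omega
  have hj1 : (j : ℝ) = -1 := by rw [hj0]; norm_num
  -- With j = -1, x = t - 1 is negative, whereas a digit at 2 would give x > ψ² - ψ⁴ > 0.
  have h2 : 2 ∉ P := by
    intro h2
    have hxe := Finset.add_sum_erase P (fun i => goldenConj ^ i) h2
    obtain ⟨hx3, hx4⟩ := conj_sum_bounds_of_pos (hP.mono (Finset.erase_subset 2 _))
      (le_of_mem_erase hP hP2 h2 : ∀ i ∈ P.erase 2, (4 : ℤ) ≤ i) psi_zpow_four (by linarith)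
    simp only [psi_zpow_two] at hxe
    linarith
  have hP3 : ∀ i ∈ P, (3 : ℤ) ≤ i := le_of_notMem hP2 h2
  refine Or.inr (Or.inl ⟨?_, Or.inr (Or.inl ⟨hj0, by linarith, ht1⟩)⟩)
  have hs := sBeta_eq_card_add_card hP hM (fun p hp m hm => by
    have := hP2 p hp; have := hM0 m hm; omega) hN
  have hs' := sBeta_eq_card_add_card (N := N + 1) (P := insert 1 P) (M := M.erase (-1))
    (legal_insert hP (by simpa using h2) (by simpa using h0)) (hM.mono (Finset.erase_subset _ _))
    (fun p hp m hm => by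
      rw [Finset.mem_insert] at hp
      have := hM0 m (Finset.mem_of_mem_erase hm)
      rcases hp with rfl | hp
      · omega
      · have := hP2 p hp; omega)
    (by
      rw [Finset.sum_insert h1]
      have h := Finset.add_sum_erase M (fun i => goldenRatio ^ i) hm
      simp only [phi_zpow_neg_one] at h
      push_cast
      rw [hN, zpow_one]
      linarith)
  rw [Finset.card_insert_of_notMem h1] at hs'
  have := Finset.card_erase_add_one hm
  unfold firstDiff
  omega

/-- Here 2 = φ + φ⁻² splits the problem: φ is added to P without 0, carrying upwards, and φ⁻² is
added to M, carrying downwards. The results stay in exponents ≥ 1 and ≤ -1, so they do not interact.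
Removing 0 costs one digit. Since j = 1, t is the conjugate sum of P without 0, so the digits of P
at 2 and 4 also control the leading digits of M. -/
theorem signMatches_of_zero_mem (hP : Legal P) (hM : Legal M) (hP0 : ∀ i ∈ P, 0 ≤ i)
    (hM0 : ∀ i ∈ M, i < 0)
    (hN : (N : ℝ) = ∑ i ∈ P, goldenRatio ^ i + ∑ i ∈ M, goldenRatio ^ i)
    (hj : ∑ i ∈ P, goldenConj ^ i = ∑ i ∈ M, goldenRatio ^ i + j)
    (h0 : 0 ∈ P) (hm : -1 ∉ M) :
    SignMatches N j (∑ i ∈ M, goldenRatio ^ i) := by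
  have hlo := lt_goldenRatio_of_decimal
  have hhi := goldenRatio_lt_of_decimal
  have hφ2 := goldenRatio_sq
  have hM1 : ∀ i ∈ M, i < -1 := fun i hi => by
    have := hM0 i hi
    have h : i ≠ -1 := fun h => hm (h ▸ hi)
    omega
  have hQ := hP.mono (Finset.erase_subset 0 P)
  have hP2 : ∀ i ∈ P.erase 0, (2 : ℤ) ≤ i := le_of_mem_erase hP hP0 h0
  have ht0 : 0 ≤ ∑ i ∈ M, goldenRatio ^ i :=
    Finset.sum_nonneg fun i _ => (zpow_pos goldenRatio_pos i).le
  have ht1 := sum_lt _ M (-1) rfl hM hM1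
  rw [phi_zpow_neg_one] at ht1
  have hxe := Finset.add_sum_erase P (fun i => goldenConj ^ i) h0
  simp only [zpow_zero] at hxe
  obtain ⟨hx1, hx2⟩ := conj_sum_bounds_of_pos hQ hP2 psi_zpow_two (by linarith)
  have hj0 : j = 1 := by
    have h3 : (0 : ℝ) < j := by linarith
    have h4 : (j : ℝ) < 2 := by nlinarith
    have h3 : 0 < j := by exact_mod_cast h3
    have h4 : j < 2 := by exact_mod_cast h4
    omega
  have hj1 : (j : ℝ) = 1 := by rw [hj0]; norm_num
  have hs := sBeta_eq_card_add_card hP hM (fun p hp m hm => by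
    have := hP0 p hp; have := hM1 m hm; omega) hN
  have hcard := Finset.card_erase_add_one h0
  have hxφ := Finset.add_sum_erase P (fun i => goldenRatio ^ i) h0
  simp only [zpow_zero] at hxφ
  obtain ⟨T, hT, hT0, hsum, hT1, -, hT2, hT3⟩ := exists_legal_add_of_lt _ (P.erase 0) 1 rfl hQ
    (fun i hi => by have := hP2 i hi; omega)
  obtain ⟨R, hR, hR0, hsum', hR1, hR2, hR3, hR4⟩ := exists_legal_add_of_le _ M (-2) rfl hM
    (fun i hi => by have := hM1 i hi; omega)
  norm_num at hT1 hT2 hT3 hR2 hR3 hR4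
  have hs' := sBeta_eq_card_add_card (N := N + 1) hT hR (fun p hp m hm => by
    have := hT0 p hp; have := hR0 m hm; omega) (by
    rw [hsum, hsum', phi_zpow_neg_two, zpow_one]; push_cast; rw [hN]; linarith)
  have hm2 : -2 ∈ M → 2 - goldenRatio ≤ ∑ i ∈ M, goldenRatio ^ i := fun h => by
    rw [← phi_zpow_neg_two]; exact zpow_le_sum h
  have hm3 : -3 ∈ M → 2 * goldenRatio - 3 ≤ ∑ i ∈ M, goldenRatio ^ i := fun h => by
    rw [← phi_zpow_neg_three]; exact zpow_le_sum h
  by_cases h2 : 2 ∈ P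
  · have h2' : (2 : ℤ) ∈ P.erase 0 := Finset.mem_erase.mpr ⟨by norm_num, h2⟩
    have hQ2 := hQ.mono (Finset.erase_subset 2 _)
    have hP4 : ∀ i ∈ (P.erase 0).erase 2, (4 : ℤ) ≤ i := le_of_mem_erase hQ hP2 h2'
    have hxe' := Finset.add_sum_erase (P.erase 0) (fun i => goldenConj ^ i) h2'
    simp only [psi_zpow_two] at hxe'
    obtain ⟨hx3, hx4⟩ := conj_sum_bounds_of_pos hQ2 hP4 psi_zpow_four (by linarith)
    by_cases h4 : 4 ∈ P
    · have h4' : (4 : ℤ) ∈ (P.erase 0).erase 2 :=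
        Finset.mem_erase.mpr ⟨by norm_num, Finset.mem_erase.mpr ⟨by norm_num, h4⟩⟩
      have hxe4 := Finset.add_sum_erase ((P.erase 0).erase 2) (fun i => goldenConj ^ i) h4'
      simp only [psi_zpow_four] at hxe4
      obtain ⟨hx5, -⟩ := conj_sum_bounds_of_pos (hQ2.mono (Finset.erase_subset 4 _))
        (le_of_mem_erase hQ2 hP4 h4' : ∀ i ∈ ((P.erase 0).erase 2).erase 4, (6 : ℤ) ≤ i)
        psi_zpow_six (by linarith)
      -- The upper part loses at least two digits in total and the lower part gains at most one.
      refine Or.inr (Or.inr ⟨?_, Or.inr (Or.inr ⟨hj0, by linarith, ht1⟩)⟩)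
      have := hT3 h2 h4
      unfold firstDiff
      omega
    · obtain ⟨hx5, hx6⟩ := conj_sum_bounds_of_neg hQ2
        (le_of_notMem hP4 (fun h => h4 (Finset.mem_of_mem_erase (Finset.mem_of_mem_erase h))) :
          ∀ i ∈ (P.erase 0).erase 2, (5 : ℤ) ≤ i) psi_zpow_five (by linarith)
      have hTc := hT2 h2 h4
      by_cases hd : -2 ∈ M
      · have hsub : ∀ i ∈ M, i ≠ -2 →
            goldenRatio ^ (-2 : ℤ) + goldenRatio ^ i ≤ ∑ i ∈ M, goldenRatio ^ i := by
          intro i hi hne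
          rw [← Finset.add_sum_erase M _ hd]
          gcongr
          exact zpow_le_sum (Finset.mem_erase.mpr ⟨hne, hi⟩)
        have hd4 : -4 ∉ M := by
          intro h
          have := hsub _ h (by norm_num)
          rw [phi_zpow_neg_two, phi_zpow_neg_four] at this
          linarith
        have hd5 : -5 ∉ M := by
          intro h
          have := hsub _ h (by norm_num)
          rw [phi_zpow_neg_two, phi_zpow_neg_five] at this
          linarith
        refine Or.inr (Or.inl ⟨?_, Or.inr (Or.inr ⟨hj0, hm2 hd, by linarith⟩)⟩)
        have := hR4 hd hd4 hd5
        unfold firstDiff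
        omega
      · have ht2 := sum_lt _ M (-2) rfl hM (fun i hi => by
          have := hM1 i hi
          have h : i ≠ -2 := fun h => hd (h ▸ hi)
          omega)
        rw [phi_zpow_neg_two] at ht2
        -- t exceeds 2φ - 3 = φ⁻³, so with -2 free the leading digit must be at -3. Then φ⁻² + φ⁻³ =
        -- φ⁻¹ gains nothing to offset the loss of 0.
        have hd3 : -3 ∈ M := by
          by_contra hd3
          have ht3 := sum_lt _ M (-3) rfl hM (fun i hi => by
            have := hM1 i hi
            have h : i ≠ -2 := fun h => hd (h ▸ hi)
            have h : i ≠ -3 := fun h => hd3 (h ▸ hi)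
            omega)
          rw [phi_zpow_neg_three] at ht3
          nlinarith
        refine Or.inr (Or.inr ⟨?_, Or.inr (Or.inl ⟨hj0, by nlinarith, ht2⟩)⟩)
        have := hR3 hd hd3
        unfold firstDiff
        omega
  · obtain ⟨hx3, hx4⟩ := conj_sum_bounds_of_neg hQ
      (le_of_notMem hP2 (fun h => h2 (Finset.mem_of_mem_erase h)) :
        ∀ i ∈ P.erase 0, (3 : ℤ) ≤ i) psi_zpow_three (by linarith)
    have htt : ∑ i ∈ M, goldenRatio ^ i < 2 * goldenRatio - 3 := by linarith
    -- Since t < φ⁻³, both -2 and -3 are free, so the upper and the lower part each gain a digit.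
    refine Or.inl ⟨?_, Or.inr ⟨hj0, ht0, htt⟩⟩
    have h5 := hR2 (fun h => by have := hm2 h; linarith) (fun h => by have := hm3 h; linarith)
    have h6 := hT1 h2
    unfold firstDiff
    omega

end Cases

/-! ### Existence of the coordinates -/

theorem exists_signMatches (N : ℕ) : ∃ b c j : ℤ, 0 ≤ b ∧ (N : ℤ) = 2 * c - b + j ∧
    SignMatches N j (c - b * goldenRatio) := by
  obtain ⟨S, hS, hN⟩ := exists_legal N
  have hP := hS.mono (Finset.filter_subset (fun i => 0 ≤ i) S)
  have hM := hS.mono (Finset.filter_subset (fun i => ¬ 0 ≤ i) S)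
  rw [← Finset.sum_filter_add_sum_filter_not S (fun i => 0 ≤ i)] at hN
  have hP0 : ∀ i ∈ S.filter (fun i => 0 ≤ i), 0 ≤ i := fun i hi => (Finset.mem_filter.mp hi).2
  have hM0 : ∀ i ∈ S.filter (fun i => ¬ 0 ≤ i), i < 0 := fun i hi =>
    not_le.mp (Finset.mem_filter.mp hi).2
  have h0m : 0 ∈ S.filter (fun i => 0 ≤ i) → -1 ∉ S.filter (fun i => ¬ 0 ≤ i) := fun h h' =>
    hS _ (Finset.mem_filter.mp h').1 (by simpa using (Finset.mem_filter.mp h).1)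
  set P := S.filter (fun i => 0 ≤ i)
  set M := S.filter (fun i => ¬ 0 ≤ i)
  obtain ⟨a, b, ha, hb⟩ := Conj.sum P
  have ht : ∑ i ∈ M, goldenRatio ^ i = ((N - a : ℤ) : ℝ) - b * goldenRatio := by
    push_cast; linarith
  refine ⟨b, N - a, 2 * a + b - N, ?_, by ring, ?_⟩
  -- Σ_P φ^i - Σ_P ψ^i = b(φ - ψ) exceeds -φ, while φ - ψ = 2φ - 1 > φ; hence b > -1.
  · obtain ⟨-, h1⟩ := conj_sum_bounds_of_pos hP hP0 (zpow_zero _) one_pos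
    have h2 : 0 ≤ ∑ i ∈ P, goldenRatio ^ i :=
      Finset.sum_nonneg fun i _ => (zpow_pos goldenRatio_pos i).le
    have hlo := lt_goldenRatio_of_decimal
    rw [hb, goldenConj_eq] at h1
    rw [ha] at h2
    have h3 : (-1 : ℝ) < b := by nlinarith
    have h3 : -1 < b := by exact_mod_cast h3
    omega
  · rw [← ht]
    have hj : ∑ i ∈ P, goldenConj ^ i =
        ∑ i ∈ M, goldenRatio ^ i + ((2 * a + b - N : ℤ) : ℝ) := by
      rw [hb, ht, goldenConj_eq]; push_cast; ring
    by_cases h0 : 0 ∈ P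
    · exact signMatches_of_zero_mem hP hM hP0 hM0 hN hj h0 (h0m h0)
    by_cases h1 : 1 ∈ P
    · exact signMatches_of_one_mem hP hM hP0 hM0 hN hj h1
    by_cases hm : -1 ∈ M
    · exact signMatches_of_neg_one_mem hP hM hP0 hM0 hN hj h0 h1 hm
    · exact signMatches_of_notMem hP hM hP0 hM0 hN hj h0 h1 hm

/-! ### Generalized Beatty sequences as windows -/

theorem mem_gbsTerms_zero_iff {p q r v : ℤ} : v ∈ gbsTerms p q r 0 ↔
    ∃ m n : ℤ, 0 ≤ n ∧ (0 ≤ n * goldenRatio - m ∧ n * goldenRatio - m < 1) ∧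
      v = p * m + q * n + r := by
  constructor
  · rintro ⟨n, -, rfl⟩
    refine ⟨⌊(n : ℝ) * goldenRatio⌋, n, Int.natCast_nonneg n, ⟨?_, ?_⟩, rfl⟩ <;> push_cast
    · linarith [Int.floor_le ((n : ℝ) * goldenRatio)]
    · linarith [Int.lt_floor_add_one ((n : ℝ) * goldenRatio)]
  · rintro ⟨m, n, hn, ⟨h1, h2⟩, rfl⟩
    lift n to ℕ using hn
    push_cast at h1 h2
    refine ⟨n, Nat.zero_le n, ?_⟩
    rw [gbs, Int.floor_eq_iff.mpr ⟨by linarith, by linarith⟩]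

/-- For n ≥ 1 irrationality makes the lower bound strict; starting the index at 1 instead of 0 thus
amounts to removing one endpoint of the window. -/
theorem mem_gbsTerms_one_iff {p q r v : ℤ} : v ∈ gbsTerms p q r 1 ↔
    ∃ m n : ℤ, 1 ≤ n ∧ (0 < n * goldenRatio - m ∧ n * goldenRatio - m < 1) ∧
      v = p * m + q * n + r := by
  constructor
  · rintro ⟨n, hn, rfl⟩
    refine ⟨⌊(n : ℝ) * goldenRatio⌋, n, by exact_mod_cast hn, ⟨?_, ?_⟩, rfl⟩ <;> push_cast
    · have h := (goldenRatio_irrational.natCast_mul (by omega : n ≠ 0)).ne_int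
        ⌊(n : ℝ) * goldenRatio⌋
      exact sub_pos.mpr (lt_of_le_of_ne (Int.floor_le _) h.symm)
    · linarith [Int.lt_floor_add_one ((n : ℝ) * goldenRatio)]
  · rintro ⟨m, n, hn, ⟨h1, h2⟩, rfl⟩
    lift n to ℕ using by omega
    push_cast at h1 h2
    refine ⟨n, by exact_mod_cast hn, ?_⟩
    rw [gbs, Int.floor_eq_iff.mpr ⟨by linarith, by linarith⟩]

/-- `v` has cut-and-project coordinates `(j, t)` with `t` in the window `I`. -/
def InWindow (v j : ℤ) (I : Set ℝ) : Prop :=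
  ∃ b c : ℤ, 0 ≤ b ∧ v = 2 * c - b + j ∧ c - b * goldenRatio ∈ I

section Windows

variable {p q r v j : ℤ} {I : Set ℝ} {t u : ℝ}

/-- The bijection (m, n) ↔ (b, c) is given by B, C and its inverse M, L. Since m stays within 1 of
nφ, m and n have essentially the same sign, so `hpos` and `hneg` match n ≥ 0 with b ≥ 0. -/
theorem mem_gbsTerms_zero_iff_inWindow (B C M L : ℤ → ℤ → ℤ)
    (hinv : ∀ b c, B (M b c) (L b c) = b ∧ C (M b c) (L b c) = c)
    (ht : ∀ m n : ℤ, C m n - B m n * goldenRatio = t + u * (n * goldenRatio - m))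
    (hI : ∀ e : ℝ, t + u * e ∈ I ↔ 0 ≤ e ∧ e < 1)
    (hpos : ∀ m n, 0 ≤ m → 0 ≤ n → 0 ≤ B m n) (hneg : ∀ m n, m ≤ -2 → n ≤ -1 → B m n < 0)
    (hv : ∀ m n, p * m + q * n + r = 2 * C m n - B m n + j) :
    v ∈ gbsTerms p q r 0 ↔ InWindow v j I := by
  have hφ := one_lt_goldenRatio
  rw [mem_gbsTerms_zero_iff]
  constructor
  · rintro ⟨m, n, hn, h, rfl⟩
    refine ⟨B m n, C m n, hpos m n ?_ hn, hv m n, ?_⟩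
    · have hn' : (0 : ℝ) ≤ n := by exact_mod_cast hn
      have h1 : (-1 : ℝ) < m := by nlinarith [h.2]
      have h1 : -1 < m := by exact_mod_cast h1
      omega
    · rw [ht, hI]; exact h
  · rintro ⟨b, c, hb, rfl, h⟩
    obtain ⟨h1, h2⟩ := hinv b c
    have h3 := ht (M b c) (L b c)
    have h4 := hv (M b c) (L b c)
    rw [h1, h2] at h3 h4
    rw [h3, hI] at h
    refine ⟨M b c, L b c, ?_, h, h4.symm⟩
    by_contra! hn
    have hn' : ((L b c : ℤ) : ℝ) ≤ -1 := by exact_mod_cast Int.le_sub_one_of_lt hn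
    have h5 : ((M b c : ℤ) : ℝ) < -1 := by nlinarith [h.1]
    have h5 : M b c < -1 := by exact_mod_cast h5
    have := hneg (M b c) (L b c) (by omega) (by omega)
    omega

theorem mem_gbsTerms_one_iff_inWindow (B C M L : ℤ → ℤ → ℤ)
    (hinv : ∀ b c, B (M b c) (L b c) = b ∧ C (M b c) (L b c) = c)
    (ht : ∀ m n : ℤ, C m n - B m n * goldenRatio = t + u * (n * goldenRatio - m))
    (hI : ∀ e : ℝ, t + u * e ∈ I ↔ 0 < e ∧ e < 1)
    (hpos : ∀ m n, 1 ≤ m → 1 ≤ n → 0 ≤ B m n) (hneg : ∀ m n, m ≤ -1 → n ≤ 0 → B m n < 0)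
    (hv : ∀ m n, p * m + q * n + r = 2 * C m n - B m n + j) :
    v ∈ gbsTerms p q r 1 ↔ InWindow v j I := by
  have hφ := one_lt_goldenRatio
  rw [mem_gbsTerms_one_iff]
  constructor
  · rintro ⟨m, n, hn, h, rfl⟩
    refine ⟨B m n, C m n, hpos m n ?_ hn, hv m n, ?_⟩
    · have hn' : (1 : ℝ) ≤ n := by exact_mod_cast hn
      have h1 : (0 : ℝ) < m := by nlinarith [h.2]
      have h1 : 0 < m := by exact_mod_cast h1
      omega
    · rw [ht, hI]; exact h
  · rintro ⟨b, c, hb, rfl, h⟩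
    obtain ⟨h1, h2⟩ := hinv b c
    have h3 := ht (M b c) (L b c)
    have h4 := hv (M b c) (L b c)
    rw [h1, h2] at h3 h4
    rw [h3, hI] at h
    refine ⟨M b c, L b c, ?_, h, h4.symm⟩
    by_contra! hn
    have hn' : ((L b c : ℤ) : ℝ) ≤ 0 := by exact_mod_cast Int.lt_add_one_iff.mp hn
    have h5 : ((M b c : ℤ) : ℝ) < 0 := by nlinarith [h.1]
    have h5 : M b c < 0 := by exact_mod_cast h5
    have := hneg (M b c) (L b c) (by omega) (by omega)
    omega

end Windows

/-! Affine images of the unit interval. -/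

section Affine

variable {t u a b e : ℝ}

theorem affine_mem_Ico_iff (hu : 0 < u) (ha : a = t) (hb : b = t + u) :
    t + u * e ∈ Set.Ico a b ↔ 0 ≤ e ∧ e < 1 := by
  subst ha hb
  rw [Set.mem_Ico, le_add_iff_nonneg_right, add_lt_add_iff_left, mul_nonneg_iff_of_pos_left hu,
    mul_lt_iff_lt_one_right hu]

theorem affine_mem_Ioo_iff (hu : 0 < u) (ha : a = t) (hb : b = t + u) :
    t + u * e ∈ Set.Ioo a b ↔ 0 < e ∧ e < 1 := by
  subst ha hb
  rw [Set.mem_Ioo, lt_add_iff_pos_right, add_lt_add_iff_left, mul_pos_iff_of_pos_left hu,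
    mul_lt_iff_lt_one_right hu]

theorem affine_mem_Ioc_iff_of_neg (hu : u < 0) (ha : a = t + u) (hb : b = t) :
    t + u * e ∈ Set.Ioc a b ↔ 0 ≤ e ∧ e < 1 := by
  subst ha hb
  exact ⟨fun ⟨h1, h2⟩ => ⟨by nlinarith, by nlinarith⟩, fun ⟨h1, h2⟩ => ⟨by nlinarith, by nlinarith⟩⟩

theorem affine_mem_Ioo_iff_of_neg (hu : u < 0) (ha : a = t + u) (hb : b = t) :
    t + u * e ∈ Set.Ioo a b ↔ 0 < e ∧ e < 1 := by
  subst ha hb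
  exact ⟨fun ⟨h1, h2⟩ => ⟨by nlinarith, by nlinarith⟩, fun ⟨h1, h2⟩ => ⟨by nlinarith, by nlinarith⟩⟩

end Affine

section Families

variable {v : ℤ}

/-- In this and the following identities t is the window endpoint attached to n = 0, and u = -ψ^k,
where φ^(-k) is the window length. The coefficients of B and C are then Fibonacci numbers; the sign
of u makes them nonnegative, and u < 0 means the window is traversed from its right end. -/
theorem mem_gbsTerms_1_2_0 :
    v ∈ gbsTerms 1 2 0 0 ↔ InWindow v 0 (Set.Ico 0 (goldenRatio - 1)) :=
  mem_gbsTerms_zero_iff_inWindow (t := 0) (u := goldenRatio - 1)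
    (fun m _ => m) (fun m n => m + n) (fun b _ => b) (fun b c => c - b)
    (fun b c => ⟨by ring, by ring⟩)
    (fun m n => by push_cast; linear_combination -(n : ℝ) * goldenRatio_sq)
    (fun e => affine_mem_Ico_iff (by linarith [one_lt_goldenRatio]) (by ring) (by ring))
    (fun m n _ _ => by omega) (fun m n _ _ => by omega) (fun m n => by ring)

theorem mem_gbsTerms_4_3_1 :
    v ∈ gbsTerms 4 3 1 0 ↔ InWindow v 1 (Set.Ico 0 (2 * goldenRatio - 3)) :=
  mem_gbsTerms_zero_iff_inWindow (t := 0) (u := 2 * goldenRatio - 3)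
    (fun m n => 2 * m + n) (fun m n => 3 * m + 2 * n) (fun b c => 2 * b - c)
    (fun b c => 2 * c - 3 * b) (fun b c => ⟨by ring, by ring⟩)
    (fun m n => by push_cast; linear_combination -2 * (n : ℝ) * goldenRatio_sq)
    (fun e => affine_mem_Ico_iff (by linarith [lt_goldenRatio_of_decimal]) (by ring) (by ring))
    (fun m n _ _ => by omega) (fun m n _ _ => by omega) (fun m n => by ring)

theorem mem_gbsTerms_3_1_1 :
    v ∈ gbsTerms 3 1 1 1 ↔ InWindow v (-1) (Set.Ioo (goldenRatio - 1) 1) :=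
  mem_gbsTerms_one_iff_inWindow (t := 1) (u := goldenRatio - 2)
    (fun m n => m + n) (fun m n => 1 + 2 * m + n) (fun b c => c - 1 - b)
    (fun b c => 2 * b - c + 1) (fun b c => ⟨by ring, by ring⟩)
    (fun m n => by push_cast; linear_combination -(n : ℝ) * goldenRatio_sq)
    (fun e => affine_mem_Ioo_iff_of_neg (by linarith [goldenRatio_lt_two]) (by ring) (by ring))
    (fun m n _ _ => by omega) (fun m n _ _ => by omega) (fun m n => by ring)

theorem mem_gbsTerms_4_3_2 : v ∈ gbsTerms 4 3 2 0 ↔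
    InWindow v (-1) (Set.Ico (2 - goldenRatio) (goldenRatio - 1)) :=
  mem_gbsTerms_zero_iff_inWindow (t := 2 - goldenRatio) (u := 2 * goldenRatio - 3)
    (fun m n => 1 + 2 * m + n) (fun m n => 2 + 3 * m + 2 * n) (fun b c => 2 * b - c)
    (fun b c => 2 * c - 3 * b - 1) (fun b c => ⟨by ring, by ring⟩)
    (fun m n => by push_cast; linear_combination -2 * (n : ℝ) * goldenRatio_sq)
    (fun e => affine_mem_Ico_iff (by linarith [lt_goldenRatio_of_decimal]) (by ring) (by ring))
    (fun m n _ _ => by omega) (fun m n _ _ => by omega) (fun m n => by ring)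

theorem mem_gbsTerms_7_4_2 : v ∈ gbsTerms 7 4 2 0 ↔
    InWindow v (-1) (Set.Ioc (2 * goldenRatio - 3) (2 - goldenRatio)) :=
  mem_gbsTerms_zero_iff_inWindow (t := 2 - goldenRatio) (u := 3 * goldenRatio - 5)
    (fun m n => 1 + 3 * m + 2 * n) (fun m n => 2 + 5 * m + 3 * n)
    (fun b c => 2 * c - 3 * b - 1) (fun b c => 5 * b - 3 * c + 1)
    (fun b c => ⟨by ring, by ring⟩)
    (fun m n => by push_cast; linear_combination -3 * (n : ℝ) * goldenRatio_sq)
    (fun e => affine_mem_Ioc_iff_of_neg (by linarith [goldenRatio_lt_of_decimal]) (by ring)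
      (by ring))
    (fun m n _ _ => by omega) (fun m n _ _ => by omega) (fun m n => by ring)

theorem mem_gbsTerms_11_7_4 : v ∈ gbsTerms 11 7 4 0 ↔
    InWindow v 1 (Set.Ico (2 - goldenRatio) (4 * goldenRatio - 6)) :=
  mem_gbsTerms_zero_iff_inWindow (t := 2 - goldenRatio) (u := 5 * goldenRatio - 8)
    (fun m n => 1 + 5 * m + 3 * n) (fun m n => 2 + 8 * m + 5 * n)
    (fun b c => 5 * b - 3 * c + 1) (fun b c => 5 * c - 8 * b - 2)
    (fun b c => ⟨by ring, by ring⟩)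
    (fun m n => by push_cast; linear_combination -5 * (n : ℝ) * goldenRatio_sq)
    (fun e => affine_mem_Ico_iff (by linarith [lt_goldenRatio_of_decimal]) (by ring) (by ring))
    (fun m n _ _ => by omega) (fun m n _ _ => by omega) (fun m n => by ring)

theorem mem_gbsTerms_4_3_neg_1 :
    v ∈ gbsTerms 4 3 (-1) 1 ↔ InWindow v (-1) (Set.Ioo 0 (2 * goldenRatio - 3)) :=
  mem_gbsTerms_one_iff_inWindow (t := 0) (u := 2 * goldenRatio - 3)
    (fun m n => 2 * m + n) (fun m n => 3 * m + 2 * n) (fun b c => 2 * b - c)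
    (fun b c => 2 * c - 3 * b) (fun b c => ⟨by ring, by ring⟩)
    (fun m n => by push_cast; linear_combination -2 * (n : ℝ) * goldenRatio_sq)
    (fun e => affine_mem_Ioo_iff (by linarith [lt_goldenRatio_of_decimal]) (by ring) (by ring))
    (fun m n _ _ => by omega) (fun m n _ _ => by omega) (fun m n => by ring)

theorem mem_gbsTerms_7_4_0 : v ∈ gbsTerms 7 4 0 1 ↔
    InWindow v 1 (Set.Ioo (4 * goldenRatio - 6) (goldenRatio - 1)) :=
  mem_gbsTerms_one_iff_inWindow (t := goldenRatio - 1) (u := 3 * goldenRatio - 5)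
    (fun m n => -1 + 3 * m + 2 * n) (fun m n => -1 + 5 * m + 3 * n)
    (fun b c => 2 * c - 3 * b - 1) (fun b c => 5 * b - 3 * c + 2)
    (fun b c => ⟨by ring, by ring⟩)
    (fun m n => by push_cast; linear_combination -3 * (n : ℝ) * goldenRatio_sq)
    (fun e => affine_mem_Ioo_iff_of_neg (by linarith [goldenRatio_lt_of_decimal]) (by ring)
      (by ring))
    (fun m n _ _ => by omega) (fun m n _ _ => by omega) (fun m n => by ring)

theorem mem_gbsTerms_7_4_4 : v ∈ gbsTerms 7 4 4 1 ↔
    InWindow v 1 (Set.Ioo (2 * goldenRatio - 3) (2 - goldenRatio)) :=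
  mem_gbsTerms_one_iff_inWindow (t := 2 - goldenRatio) (u := 3 * goldenRatio - 5)
    (fun m n => 1 + 3 * m + 2 * n) (fun m n => 2 + 5 * m + 3 * n)
    (fun b c => 2 * c - 3 * b - 1) (fun b c => 5 * b - 3 * c + 1)
    (fun b c => ⟨by ring, by ring⟩)
    (fun m n => by push_cast; linear_combination -3 * (n : ℝ) * goldenRatio_sq)
    (fun e => affine_mem_Ioo_iff_of_neg (by linarith [goldenRatio_lt_of_decimal]) (by ring)
      (by ring))
    (fun m n _ _ => by omega) (fun m n _ _ => by omega) (fun m n => by ring)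

end Families

/-! ### Uniqueness of the coordinates -/

/-- The cut-and-project coordinates that occur. -/
def ValidCoords (j : ℤ) (t : ℝ) : Prop :=
  0 ≤ t ∧ t < 1 ∧ (j = -1 ∨ ((j = 0 ∨ j = 1) ∧ t < goldenRatio - 1))

theorem IncreaseRegion.valid {j : ℤ} {t : ℝ} (h : IncreaseRegion j t) : ValidCoords j t := by
  have hlo := lt_goldenRatio_of_decimal
  have hhi := goldenRatio_lt_of_decimal
  rcases h with ⟨hj, h1, h2⟩ | ⟨hj, h1, h2⟩
  · exact ⟨h1, by linarith, Or.inr ⟨Or.inl hj, h2⟩⟩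
  · exact ⟨h1, by linarith, Or.inr ⟨Or.inr hj, by linarith⟩⟩

theorem ConstancyRegion.valid {j : ℤ} {t : ℝ} (h : ConstancyRegion j t) : ValidCoords j t := by
  have hlo := lt_goldenRatio_of_decimal
  have hhi := goldenRatio_lt_of_decimal
  rcases h with ⟨hj, h1, h2⟩ | ⟨hj, h1, h2⟩ | ⟨hj, h1, h2⟩
  · exact ⟨by linarith, by linarith, Or.inl hj⟩
  · exact ⟨by linarith, by linarith, Or.inl hj⟩
  · exact ⟨by linarith, by linarith, Or.inr ⟨Or.inr hj, by linarith⟩⟩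

theorem DecreaseRegion.valid {j : ℤ} {t : ℝ} (h : DecreaseRegion j t) : ValidCoords j t := by
  have hlo := lt_goldenRatio_of_decimal
  have hhi := goldenRatio_lt_of_decimal
  rcases h with ⟨hj, h1, h2⟩ | ⟨hj, h1, h2⟩ | ⟨hj, h1, h2⟩
  · exact ⟨by linarith, by linarith, Or.inl hj⟩
  · exact ⟨by linarith, by linarith, Or.inr ⟨Or.inr hj, by linarith⟩⟩
  · exact ⟨by linarith, by linarith, Or.inr ⟨Or.inr hj, by linarith⟩⟩

theorem SignMatches.valid {N : ℕ} {j : ℤ} {t : ℝ} (h : SignMatches N j t) : ValidCoords j t := by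
  rcases h with ⟨-, h⟩ | ⟨-, h⟩ | ⟨-, h⟩
  exacts [h.valid, h.valid, h.valid]

theorem ValidCoords.bounds {j : ℤ} {t : ℝ} (h : ValidCoords j t) :
    -1 ≤ 2 * t + j ∧ 2 * t + j < 2 * goldenRatio - 1 := by
  have hlo := lt_goldenRatio_of_decimal
  obtain ⟨h0, h1, rfl | ⟨rfl | rfl, h2⟩⟩ := h <;> push_cast <;> constructor <;> linarith

/-- The represented integer is b(2φ - 1) + (2t + j), and 2t + j ranges over an interval of length 2φ
< 2(2φ - 1), so b' - b is 0 or 1. If it is 0, then |c - c'| = |t - t'| < 1. If it is 1, then c' - c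
is 1 or 2, and j - j' is 1 or 3 accordingly. The value 3 is out of range; the value 1 forces j ∈ {0,
1}, so t < φ - 1 and t' = t + 1 - φ < 0. -/
theorem coords_unique_of_le {b c j b' c' j' : ℤ} (h : ValidCoords j (c - b * goldenRatio))
    (h' : ValidCoords j' (c' - b' * goldenRatio)) (heq : 2 * c - b + j = 2 * c' - b' + j')
    (hle : b ≤ b') : b = b' ∧ c = c' ∧ j = j' := by
  have hlo := lt_goldenRatio_of_decimal
  have hhi := goldenRatio_lt_of_decimal
  have hb := h.bounds
  have hb' := h'.bounds
  have heqR : (2 * c - b + j : ℝ) = 2 * c' - b' + j' := by exact_mod_cast heq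
  obtain ⟨h0, h1, h2⟩ := h
  obtain ⟨h0', h1', h2'⟩ := h'
  have hd : (b' : ℝ) - b < 2 := by nlinarith
  have hd : b' - b < 2 := by exact_mod_cast hd
  obtain rfl | rfl : b' = b ∨ b' = b + 1 := by omega
  · have h3 : (c : ℝ) - c' < 1 := by linarith
    have h4 : (-1 : ℝ) < c - c' := by linarith
    have h3 : c - c' < 1 := by exact_mod_cast h3
    have h4 : -1 < c - c' := by exact_mod_cast h4
    refine ⟨rfl, by omega, by omega⟩
  · exfalso
    push_cast at h0' h1' h2'
    have h3 : (c : ℝ) - c' < 0 := by nlinarith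
    have h4 : (-3 : ℝ) < c - c' := by nlinarith
    have h3 : c - c' < 0 := by exact_mod_cast h3
    have h4 : -3 < c - c' := by exact_mod_cast h4
    obtain rfl | rfl : c' = c + 1 ∨ c' = c + 2 := by omega
    · rcases h2 with rfl | ⟨hj, h2⟩
      · rcases h2' with h | ⟨h | h, -⟩ <;> omega
      · push_cast at h0'
        linarith
    · rcases h2 with h | ⟨h | h, -⟩ <;> rcases h2' with h' | ⟨h' | h', -⟩ <;> omega

theorem coords_unique {b c j b' c' j' : ℤ} (h : ValidCoords j (c - b * goldenRatio))
    (h' : ValidCoords j' (c' - b' * goldenRatio)) (heq : 2 * c - b + j = 2 * c' - b' + j') :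
    b = b' ∧ c = c' ∧ j = j' := by
  rcases le_total b b' with hle | hle
  · exact coords_unique_of_le h h' heq hle
  · obtain ⟨h1, h2, h3⟩ := coords_unique_of_le h' h heq.symm hle
    exact ⟨h1.symm, h2.symm, h3.symm⟩

theorem increase_disjoint_constancy {j : ℤ} {t : ℝ} (h : IncreaseRegion j t)
    (h' : ConstancyRegion j t) : False := by
  have hlo := lt_goldenRatio_of_decimal
  have hhi := goldenRatio_lt_of_decimal
  rcases h with ⟨hj, h1, h2⟩ | ⟨hj, h1, h2⟩ <;>
    rcases h' with ⟨hj', h1', h2'⟩ | ⟨hj', h1', h2'⟩ | ⟨hj', h1', h2'⟩ <;>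
    first | omega | linarith

theorem increase_disjoint_decrease {j : ℤ} {t : ℝ} (h : IncreaseRegion j t)
    (h' : DecreaseRegion j t) : False := by
  have hlo := lt_goldenRatio_of_decimal
  have hhi := goldenRatio_lt_of_decimal
  rcases h with ⟨hj, h1, h2⟩ | ⟨hj, h1, h2⟩ <;>
    rcases h' with ⟨hj', h1', h2'⟩ | ⟨hj', h1', h2'⟩ | ⟨hj', h1', h2'⟩ <;>
    first | omega | linarith

theorem constancy_disjoint_decrease {j : ℤ} {t : ℝ} (h : ConstancyRegion j t)
    (h' : DecreaseRegion j t) : False := by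
  have hlo := lt_goldenRatio_of_decimal
  have hhi := goldenRatio_lt_of_decimal
  rcases h with ⟨hj, h1, h2⟩ | ⟨hj, h1, h2⟩ | ⟨hj, h1, h2⟩ <;>
    rcases h' with ⟨hj', h1', h2'⟩ | ⟨hj', h1', h2'⟩ | ⟨hj', h1', h2'⟩ <;>
    first | omega | linarith

/-! ### From regions to the sign of the first difference -/

/-- `v` has cut-and-project coordinates in the region `R`. -/
def InRegion (v : ℤ) (R : ℤ → ℝ → Prop) : Prop :=
  ∃ b c j : ℤ, 0 ≤ b ∧ v = 2 * c - b + j ∧ R j (c - b * goldenRatio)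

theorem inRegion_increase_iff {v : ℤ} : InRegion v IncreaseRegion ↔
    v ∈ gbsTerms 1 2 0 0 ∪ gbsTerms 4 3 1 0 := by
  rw [Set.mem_union, mem_gbsTerms_1_2_0, mem_gbsTerms_4_3_1]
  constructor
  · rintro ⟨b, c, j, hb, hv, ⟨rfl, h⟩ | ⟨rfl, h⟩⟩
    exacts [Or.inl ⟨b, c, hb, hv, h⟩, Or.inr ⟨b, c, hb, hv, h⟩]
  · rintro (⟨b, c, hb, hv, h⟩ | ⟨b, c, hb, hv, h⟩)
    exacts [⟨b, c, _, hb, hv, Or.inl ⟨rfl, h⟩⟩, ⟨b, c, _, hb, hv, Or.inr ⟨rfl, h⟩⟩]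

theorem inRegion_constancy_iff {v : ℤ} : InRegion v ConstancyRegion ↔
    v ∈ gbsTerms 3 1 1 1 ∪ gbsTerms 4 3 2 0 ∪ gbsTerms 7 4 2 0 ∪ gbsTerms 11 7 4 0 := by
  have hlo := lt_goldenRatio_of_decimal
  have hhi := goldenRatio_lt_of_decimal
  simp only [Set.mem_union, mem_gbsTerms_3_1_1, mem_gbsTerms_4_3_2, mem_gbsTerms_7_4_2,
    mem_gbsTerms_11_7_4]
  constructor
  · rintro ⟨b, c, j, hb, hv, ⟨rfl, h1, h2⟩ | ⟨rfl, h⟩ | ⟨rfl, h⟩⟩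
    · rcases le_total ((c : ℝ) - b * goldenRatio) (2 - goldenRatio) with h | h
      · exact Or.inl (Or.inr ⟨b, c, hb, hv, h1, h⟩)
      · exact Or.inl (Or.inl (Or.inr ⟨b, c, hb, hv, h, h2⟩))
    · exact Or.inl (Or.inl (Or.inl ⟨b, c, hb, hv, h⟩))
    · exact Or.inr ⟨b, c, hb, hv, h⟩
  · rintro (((⟨b, c, hb, hv, h⟩ | ⟨b, c, hb, hv, h1, h2⟩) | ⟨b, c, hb, hv, h1, h2⟩) |
      ⟨b, c, hb, hv, h⟩)
    · exact ⟨b, c, _, hb, hv, Or.inr (Or.inl ⟨rfl, h⟩)⟩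
    · exact ⟨b, c, _, hb, hv, Or.inl ⟨rfl, by linarith, h2⟩⟩
    · exact ⟨b, c, _, hb, hv, Or.inl ⟨rfl, h1, by linarith⟩⟩
    · exact ⟨b, c, _, hb, hv, Or.inr (Or.inr ⟨rfl, h⟩)⟩

theorem inRegion_decrease_iff {v : ℤ} : InRegion v DecreaseRegion ↔
    v ∈ gbsTerms 4 3 (-1) 1 ∪ gbsTerms 7 4 0 1 ∪ gbsTerms 7 4 4 1 := by
  simp only [Set.mem_union, mem_gbsTerms_4_3_neg_1, mem_gbsTerms_7_4_0, mem_gbsTerms_7_4_4]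
  constructor
  · rintro ⟨b, c, j, hb, hv, ⟨rfl, h⟩ | ⟨rfl, h⟩ | ⟨rfl, h⟩⟩
    exacts [Or.inl (Or.inl ⟨b, c, hb, hv, h⟩), Or.inr ⟨b, c, hb, hv, h⟩,
      Or.inl (Or.inr ⟨b, c, hb, hv, h⟩)]
  · rintro ((⟨b, c, hb, hv, h⟩ | ⟨b, c, hb, hv, h⟩) | ⟨b, c, hb, hv, h⟩)
    exacts [⟨b, c, _, hb, hv, Or.inl ⟨rfl, h⟩⟩, ⟨b, c, _, hb, hv, Or.inr (Or.inr ⟨rfl, h⟩)⟩,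
      ⟨b, c, _, hb, hv, Or.inr (Or.inl ⟨rfl, h⟩)⟩]

/-- By uniqueness, any valid coordinates of `N` are those read off from its digits; this yields the
implication from window to sign. -/
theorem InRegion.signMatches {N : ℕ} {R : ℤ → ℝ → Prop} (hR : ∀ j t, R j t → ValidCoords j t)
    (h : InRegion N R) : ∃ j t, R j t ∧ SignMatches N j t := by
  obtain ⟨b, c, j, -, hv, h⟩ := h
  obtain ⟨b', c', j', -, hv', h'⟩ := exists_signMatches N
  obtain ⟨rfl, rfl, rfl⟩ := coords_unique (hR _ _ h) h'.valid (hv.symm.trans hv')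
  exact ⟨_, _, h, h'⟩

theorem firstDiff_pos_iff {N : ℕ} : 0 < firstDiff sBeta N ↔ InRegion N IncreaseRegion := by
  constructor
  · intro h
    obtain ⟨b, c, j, hb, hv, ⟨-, h'⟩ | ⟨h', -⟩ | ⟨h', -⟩⟩ := exists_signMatches N
    exacts [⟨b, c, j, hb, hv, h'⟩, by omega, by omega]
  · intro h
    obtain ⟨j, t, hR, ⟨h', -⟩ | ⟨-, h'⟩ | ⟨-, h'⟩⟩ := h.signMatches fun _ _ h => h.valid
    exacts [h', (increase_disjoint_constancy hR h').elim, (increase_disjoint_decrease hR h').elim]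

theorem firstDiff_eq_zero_iff {N : ℕ} : firstDiff sBeta N = 0 ↔ InRegion N ConstancyRegion := by
  constructor
  · intro h
    obtain ⟨b, c, j, hb, hv, ⟨h', -⟩ | ⟨-, h'⟩ | ⟨h', -⟩⟩ := exists_signMatches N
    exacts [by omega, ⟨b, c, j, hb, hv, h'⟩, by omega]
  · intro h
    obtain ⟨j, t, hR, ⟨-, h'⟩ | ⟨h', -⟩ | ⟨-, h'⟩⟩ := h.signMatches fun _ _ h => h.valid
    exacts [(increase_disjoint_constancy h' hR).elim, h', (constancy_disjoint_decrease hR h').elim]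

theorem firstDiff_neg_iff {N : ℕ} : firstDiff sBeta N < 0 ↔ InRegion N DecreaseRegion := by
  constructor
  · intro h
    obtain ⟨b, c, j, hb, hv, ⟨h', -⟩ | ⟨h', -⟩ | ⟨-, h'⟩⟩ := exists_signMatches N
    exacts [by omega, by omega, ⟨b, c, j, hb, hv, h'⟩]
  · intro h
    obtain ⟨j, t, hR, ⟨-, h'⟩ | ⟨-, h'⟩ | ⟨h', -⟩⟩ := h.signMatches fun _ _ h => h.valid
    exacts [(increase_disjoint_decrease h' hR).elim, (constancy_disjoint_decrease h' hR).elim, h']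

/-- Integers with valid cut-and-project coordinates are natural numbers. -/
theorem InRegion.nonneg {v : ℤ} {R : ℤ → ℝ → Prop} (hR : ∀ j t, R j t → ValidCoords j t)
    (h0 : ¬ R (-1) 0) (h : InRegion v R) : 0 ≤ v := by
  have hlo := lt_goldenRatio_of_decimal
  obtain ⟨b, c, j, hb, rfl, h⟩ := h
  have hv := (hR _ _ h).bounds
  have hb' : (0 : ℝ) ≤ b := by exact_mod_cast hb
  -- v = b(2φ - 1) + (2t + j) with 2t + j ≥ -1. A negative v must therefore be -1, which forces b =
  -- 0, t = 0, j = -1, the point excluded by `h0`.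
  have h1 : (-1 : ℝ) ≤ 2 * c - b + j := by nlinarith
  have h1 : -1 ≤ 2 * c - b + j := by exact_mod_cast h1
  by_contra hneg
  have h2 : (2 * c - b + j : ℝ) = -1 := by
    exact_mod_cast (by omega : 2 * c - b + j = -1)
  have hb0 : b = 0 := by
    have h3 : (b : ℝ) < 1 := by nlinarith
    have h3 : b < 1 := by exact_mod_cast h3
    omega
  subst hb0
  obtain ⟨hc0, hc1, -⟩ := hR _ _ h
  have hc : c = 0 := by
    push_cast at hc0 hc1
    have h3 : (0 : ℝ) ≤ c := by linarith
    have h4 : (c : ℝ) < 1 := by linarith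
    have h3 : 0 ≤ c := by exact_mod_cast h3
    have h4 : c < 1 := by exact_mod_cast h4
    omega
  subst hc
  obtain rfl : j = -1 := by omega
  exact h0 (by simpa using h)

theorem image_natCast_eq {s : Set ℕ} {R : ℤ → ℝ → Prop} {T : Set ℤ}
    (hR : ∀ j t, R j t → ValidCoords j t) (h0 : ¬ R (-1) 0) (hs : ∀ N, N ∈ s ↔ InRegion N R)
    (hT : ∀ v, InRegion v R ↔ v ∈ T) : (fun N : ℕ => (N : ℤ)) '' s = T := by
  ext v
  constructor
  · rintro ⟨N, hN, rfl⟩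
    exact (hT _).mp ((hs N).mp hN)
  · intro hv
    have hv := (hT v).mpr hv
    obtain ⟨N, rfl⟩ := Int.eq_ofNat_of_zero_le (hv.nonneg hR h0)
    exact ⟨N, (hs N).mpr hv, rfl⟩

end BasePhi

theorem mainTheorem1 :
    ((fun N : ℕ => (N : ℤ)) '' pointsOfIncrease sBeta =
        gbsTerms 1 2 0 0 ∪ gbsTerms 4 3 1 0) ∧
      ((fun N : ℕ => (N : ℤ)) '' pointsOfConstancy sBeta =
        gbsTerms 3 1 1 1 ∪ gbsTerms 4 3 2 0 ∪ gbsTerms 7 4 2 0 ∪ gbsTerms 11 7 4 0) ∧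
      ((fun N : ℕ => (N : ℤ)) '' pointsOfDecrease sBeta =
        gbsTerms 4 3 (-1) 1 ∪ gbsTerms 7 4 0 1 ∪ gbsTerms 7 4 4 1) := by
  have hlo := BasePhi.lt_goldenRatio_of_decimal
  refine ⟨BasePhi.image_natCast_eq (fun _ _ h => h.valid) ?_
      (fun _ => BasePhi.firstDiff_pos_iff) fun _ => BasePhi.inRegion_increase_iff,
    BasePhi.image_natCast_eq (fun _ _ h => h.valid) ?_
      (fun _ => BasePhi.firstDiff_eq_zero_iff) fun _ => BasePhi.inRegion_constancy_iff,
    BasePhi.image_natCast_eq (fun _ _ h => h.valid) ?_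
      (fun _ => BasePhi.firstDiff_neg_iff) fun _ => BasePhi.inRegion_decrease_iff⟩
  · rintro (⟨h, -⟩ | ⟨h, -⟩) <;> omega
  · rintro (⟨-, h, -⟩ | ⟨-, h, -⟩ | ⟨h, -⟩)
    · linarith
    · linarith
    · omega
  · rintro (⟨-, h, -⟩ | ⟨h, -⟩ | ⟨h, -⟩)
    -- The point j = -1, t = 0 would be the term -1 of 4⌊nφ⌋ + 3n - 1 at n = 0.
    · exact lt_irrefl _ h
    · omega
    · omega
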